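/- Let $\mathscr G$ be an ample groupoid, i.e. a topological groupoid whose unit space $\mathscr G^{(0)}$ is locally compact Hausdorff with a basis of compact open sets and whose range map $r$ is a local homeomorphism onto $\mathscr G^{(0)}$; write $d$ for the source map. Let $\mathcal O$ be a $\mathscr G$-sheaf of unital rings, i.e. a local homeomorphism $p\colon E\to\mathscr G^{(0)}$ with unital ring structures on the stalks $\mathcal O_x=p^{-1}(x)$ such that addition, multiplication and the unit section are continuous, together with a continuous action of $\mathscr G$ on $E$ by ring isomorphisms $\alpha_\gamma\colon\mathcal O_{d(\gamma)}\to\mathcal O_{r(\gamma)}$. Let $R=\Gamma_c(\mathscr G,\mathcal O)$ be the convolution ring: the additive group generated by the maps $f\colon\mathscr G\to E$ with $f(\gamma)\in\mathcal O_{r(\gamma)}$ that are continuous on some compact open bisection $U$ and vanish off $U$, with product $(f*g)(\gamma)=\sum_{\beta\rho=\gamma}f(\beta)\alpha_\beta(g(\rho))$. For a unit $x$ let $\mathscr G_x^x$ be the isotropy group, $B_x=\mathcal O_x\rtimes\mathscr G_x^x$ the skew group ring, and $\mathcal L_x=\bigoplus_{d(\gamma)=x}\mathcal O_{r(\gamma)}$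 the $R$-$B_x$-bimodule with $$f\cdot a1_\gamma=\sum_{d(\beta)=r(\gamma)}f(\beta)\alpha_\beta(a)1_{\beta\gamma},\qquad a1_\gamma\cdot b\delta=a\alpha_\gamma(b)1_{\gamma\delta}.$$ For a left $B_x$-module $M$ put $\mathrm{Ind}_x(M)=\mathcal L_x\otimes_{B_x}M$. A simple $R$-module is a non-zero left $R$-module $S$ with $RS=S$ whose only submodules are $0$ and $S$; an ideal is (left) primitive if it is the annihilator of a simple left $R$-module. For a left $R$-module $S$ let $\mathrm{Sh}(S)$ be the associated $\mathscr G$-sheaf of $\mathcal O$-modules: its stalk at $x$ is $S_x=S/N_x$, where $N_x=\{m\in S:\chi_Vm=0$ for some compact open $V\subseteq\mathscr G^{(0)}$ with $x\in V\}$; its topology has as basis the sets $\{[m]_x: x\in V\}$ ($m\in S$, $V\subseteq\mathscr G^{(0)}$ compact open); the $\mathcal O_x$-action is $a[m]_x=[tm]_x$ for a compactly supported section $t$ of $\mathcal O$ over $\mathscr G^{(0)}$ with $t(x)=a$; and $\beta_\gamma([m]_{d(\gamma)})=[\chi_Um]_{r(\gamma)}$ for a compact open bisection $U\ni\gamma$.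 The stalk $S_x$ is a left $B_x$-module via $b\delta\cdot m=b\,\beta_\delta(m)$. **Theorem.** Let $I$ be a primitive ideal of $R$. Then there exist $x\in\mathscr G^{(0)}$ and a left $B_x$-module $M$ such that $I=\mathrm{Ann}(\mathrm{Ind}_x(M))$. Moreover, $M$ can be taken to be a stalk of the sheaf of a simple module: for every simple left $R$-module $S$ with $I=\mathrm{Ann}(S)$ there is a unit $x$ with $S_x\ne0$, and for every unit $x$ with $S_x\neq 0$ one has $I=\mathrm{Ann}(\mathrm{Ind}_x(S_x))$. -/

import Mathlib

open CategoryTheory TopologicalSpace Topology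
open scoped DirectSum TensorProduct Classical

universe u v w z

set_option linter.unusedSectionVars false

noncomputable section

namespace AmpleSheaf

/-! ### Ample groupoids -/

section Groupoids

/-- The arrow space `𝒢⁽¹⁾` of a groupoid: `γ : src ⟶ tgt` has `d(γ) = src` and `r(γ) = tgt`.
The product `βγ` of two arrows with `d(β) = r(γ)` is `γ ≫ β`. -/
@[ext] structure Arr (X : Type u) [Groupoid.{v} X] : Type (max u v) where
  src : X
  tgt : X
  hom : src ⟶ tgt

/-- Pairs `(γ, β)` of arrows with `r(γ) = d(β)`. -/
structure ComposablePair (X : Type u) [Groupoid.{v} X] : Type (max u v) where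
  src : X
  mid : X
  tgt : X
  fst : src ⟶ mid
  snd : mid ⟶ tgt

variable {X : Type u} [Groupoid.{v} X]

/-- The arrow `γ` as a point of the arrow space. -/
abbrev arr {x y : X} (γ : x ⟶ y) : Arr X := ⟨x, y, γ⟩

/-- The unit at `x`. -/
abbrev unit (x : X) : Arr X := arr (𝟙 x)

/-- Composable pairs carry the subspace topology of the product of two copies of the arrow space. -/
instance ComposablePair.instTopologicalSpace [TopologicalSpace (Arr X)] :
    TopologicalSpace (ComposablePair X) :=
  TopologicalSpace.induced (fun p => (arr p.fst, arr p.snd)) inferInstance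

end Groupoids

/-- An ample groupoid: a topological groupoid whose unit space `X` is locally compact Hausdorff with
a basis of compact open sets and whose range map is a local homeomorphism.
The unit space is presented as the space `X` of objects. -/
class AmpleGroupoid (X : Type u) [TopologicalSpace X] [Groupoid.{v} X] where
  [topArr : TopologicalSpace (Arr X)]
  continuous_src : Continuous (Arr.src : Arr X → X)
  continuous_tgt : Continuous (Arr.tgt : Arr X → X)
  continuous_unit : Continuous (unit : X → Arr X)
  continuous_inv : Continuous fun γ : Arr X => arr (Groupoid.inv γ.hom)
  continuous_comp : Continuous fun p : ComposablePair X => arr (p.fst ≫ p.snd)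
  t2Space : T2Space X
  locallyCompactSpace : LocallyCompactSpace X
  isLocalHomeomorph_tgt : IsLocalHomeomorph (Arr.tgt : Arr X → X)
  isTopologicalBasis : IsTopologicalBasis {U : Set X | IsOpen U ∧ IsCompact U}

attribute [reducible] AmpleGroupoid.topArr
attribute [instance] AmpleGroupoid.topArr AmpleGroupoid.t2Space

/-- Compact open bisections. (The range map embeds such a set into the Hausdorff unit space,
so it is automatically a Hausdorff subspace.) -/
structure IsCompactOpenBisection {X : Type u} [TopologicalSpace X] [Groupoid.{v} X]
    [AmpleGroupoid X] (U : Set (Arr X)) : Prop where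
  isCompact : IsCompact U
  isOpen : IsOpen U
  injOn_src : Set.InjOn Arr.src U
  injOn_tgt : Set.InjOn Arr.tgt U

/-! ### Sheaves of rings and of modules -/

section Total

variable {X : Type u}

/-- The disjoint union `E = ∐ₓ Aₓ` of a family of stalks; `pt` is the projection `p : E → X`. -/
@[ext] structure Total (A : X → Type w) : Type (max u w) where
  pt : X
  val : A pt

/-- The fibre product `E ×_X F`. -/
structure FiberProd (A : X → Type w) (B : X → Type z) : Type (max u w z) where
  pt : X
  fst : A pt
  snd : B pt

/-- The pullback `𝒢⁽¹⁾ ×_{d,p} E`. -/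
structure ActPair [Groupoid.{v} X] (A : X → Type w) : Type (max u v w) where
  arrow : Arr X
  val : A arrow.src

instance FiberProd.instTopologicalSpace (A : X → Type w) (B : X → Type z)
    [TopologicalSpace (Total A)] [TopologicalSpace (Total B)] :
    TopologicalSpace (FiberProd A B) :=
  TopologicalSpace.induced
    (fun p => ((⟨p.pt, p.fst⟩ : Total A), (⟨p.pt, p.snd⟩ : Total B))) inferInstance

instance ActPair.instTopologicalSpace [Groupoid.{v} X] (A : X → Type w)
    [TopologicalSpace (Arr X)] [TopologicalSpace (Total A)] :
    TopologicalSpace (ActPair A) :=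
  TopologicalSpace.induced
    (fun p => (p.arrow, (⟨p.arrow.src, p.val⟩ : Total A))) inferInstance

end Total

/-- A `𝒢`-sheaf of unital rings `𝒪 = (E, p, α)`; `E` is the disjoint union of the stalks, `p` the
projection, and `act γ` is `α_γ`. -/
structure SheafOfRings (X : Type u) [TopologicalSpace X] [Groupoid.{v} X] [AmpleGroupoid X] :
    Type (max u v (w + 1)) where
  stalk : X → Type w
  [ring : ∀ x, Ring (stalk x)]
  [top : TopologicalSpace (Total stalk)]
  isLocalHomeomorph_pt : IsLocalHomeomorph (Total.pt : Total stalk → X)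
  act : ∀ {x y : X}, (x ⟶ y) → stalk x →+* stalk y
  act_id : ∀ (x : X) (a : stalk x), act (𝟙 x) a = a
  act_comp : ∀ {x y z : X} (γ : x ⟶ y) (β : y ⟶ z) (a : stalk x),
    act β (act γ a) = act (γ ≫ β) a
  continuous_act : Continuous fun p : ActPair stalk =>
    (⟨p.arrow.tgt, act p.arrow.hom p.val⟩ : Total stalk)
  continuous_add : Continuous fun p : FiberProd stalk stalk =>
    (⟨p.pt, p.fst + p.snd⟩ : Total stalk)
  continuous_mul : Continuous fun p : FiberProd stalk stalk =>
    (⟨p.pt, p.fst * p.snd⟩ : Total stalk)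
  continuous_one : Continuous fun x : X => (⟨x, 1⟩ : Total stalk)

attribute [instance] SheafOfRings.ring SheafOfRings.top

variable {X : Type u} [TopologicalSpace X] [Groupoid.{v} X] [AmpleGroupoid X]

/-- A `𝒢`-sheaf of `𝒪`-modules `ℳ = (F, q, β)`; `act γ` is `β_γ`. -/
structure SheafOfModules (O : SheafOfRings.{u, v, w} X) : Type (max u v w (z + 1)) where
  stalk : X → Type z
  [addCommGroup : ∀ x, AddCommGroup (stalk x)]
  [module : ∀ x, Module (O.stalk x) (stalk x)]
  [top : TopologicalSpace (Total stalk)]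
  isLocalHomeomorph_pt : IsLocalHomeomorph (Total.pt : Total stalk → X)
  act : ∀ {x y : X}, (x ⟶ y) → stalk x →+ stalk y
  act_id : ∀ (x : X) (m : stalk x), act (𝟙 x) m = m
  act_comp : ∀ {x y z : X} (γ : x ⟶ y) (β : y ⟶ z) (m : stalk x),
    act β (act γ m) = act (γ ≫ β) m
  act_smul : ∀ {x y : X} (γ : x ⟶ y) (a : O.stalk x) (m : stalk x),
    act γ (a • m) = O.act γ a • act γ m
  continuous_act : Continuous fun p : ActPair stalk =>
    (⟨p.arrow.tgt, act p.arrow.hom p.val⟩ : Total stalk)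
  continuous_add : Continuous fun p : FiberProd stalk stalk =>
    (⟨p.pt, p.fst + p.snd⟩ : Total stalk)
  continuous_smul : Continuous fun p : FiberProd O.stalk stalk =>
    (⟨p.pt, p.fst • p.snd⟩ : Total stalk)

attribute [instance] SheafOfModules.addCommGroup SheafOfModules.module SheafOfModules.top

variable (O : SheafOfRings.{u, v, w} X)

/-! ### The convolution algebra -/

/-- `A(𝒢, 𝒪)`: all maps `f` with `f(γ) ∈ 𝒪_{r(γ)}`. -/
abbrev ArrowMap : Type (max u v w) := ∀ γ : Arr X, O.stalk γ.tgt

variable {O}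

/-- `f` is continuous on `U` and vanishes outside of `U`. -/
def SupportedOn (f : ArrowMap O) (U : Set (Arr X)) : Prop :=
  ContinuousOn (fun γ => (⟨γ.tgt, f γ⟩ : Total O.stalk)) U ∧ ∀ γ, γ ∉ U → f γ = 0

variable (O)

/-- `Γ_c(𝒢, 𝒪)` as a subgroup of `A(𝒢, 𝒪)`. -/
def gammaSubgroup : AddSubgroup (ArrowMap O) :=
  AddSubgroup.closure {f | ∃ U : Set (Arr X), IsCompactOpenBisection U ∧ SupportedOn f U}

/-- `Γ_c(𝒢, 𝒪)`. -/
def Gamma : Type (max u v w) := gammaSubgroup O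

instance : AddCommGroup (Gamma O) := inferInstanceAs (AddCommGroup (gammaSubgroup O))

variable {O}

instance : CoeFun (Gamma O) (fun _ => ArrowMap O) := ⟨fun f => f.1⟩

/-- Convolution, `(f * g)(γ) = ∑_{βρ = γ} f(β) α_β(g(ρ))`; the factorizations `γ = βρ` are indexed by
the arrows `β` with range `r(γ)`, the other factor being `ρ = β⁻¹γ`. -/
def conv (f g : ArrowMap O) : ArrowMap O := fun γ =>
  ∑ᶠ b : (Σ y : X, (y ⟶ γ.tgt)), f (arr b.2) * O.act b.2 (g (arr (γ.hom ≫ Groupoid.inv b.2)))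


/-! #### Finiteness on the fibres of `d` and `r` -/

section Finiteness

theorem exists_section_of_isOpenMap {Y : Type*} {Z : Type*} [TopologicalSpace Y]
    [TopologicalSpace Z] {f : Y → Z} (hf : IsOpenMap f) {U : Set Y} (hU : IsOpen U)
    (hi : Set.InjOn f U) (hY : Nonempty Y) :
    ∃ σ : Z → Y, (∀ y ∈ U, σ (f y) = y) ∧ ContinuousOn σ (f '' U) := by
  refine ⟨Function.invFunOn f U, fun y hy => hi.leftInvOn_invFunOn hy, ?_⟩
  have hl : ∀ y ∈ U, Function.invFunOn f U (f y) = y := fun y hy => hi.leftInvOn_invFunOn hy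
  rintro _ ⟨y, hy, rfl⟩
  rw [ContinuousWithinAt, hl y hy, (hf U hU).nhdsWithin_eq ⟨y, hy, rfl⟩]
  intro W hW
  have : f '' (W ∩ U) ∈ 𝓝 (f y) := hf.image_mem_nhds (Filter.inter_mem hW (hU.mem_nhds hy))
  rw [Filter.mem_map]
  filter_upwards [this]
  rintro _ ⟨y', ⟨h1, h2⟩, rfl⟩
  simpa [hl y' h2] using h1

theorem isOpenMap_tgt : IsOpenMap (Arr.tgt : Arr X → X) :=
  AmpleGroupoid.isLocalHomeomorph_tgt.isOpenMap

theorem isOpenMap_src : IsOpenMap (Arr.src : Arr X → X) := by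
  intro U hU
  have h : Arr.src '' U = Arr.tgt '' ((fun γ : Arr X => arr (Groupoid.inv γ.hom)) ⁻¹' U) := by
    ext x
    constructor
    · rintro ⟨γ, hγ, rfl⟩
      exact ⟨arr (Groupoid.inv γ.hom), by simpa using hγ, rfl⟩
    · rintro ⟨γ, hγ, rfl⟩
      exact ⟨_, hγ, rfl⟩
  rw [h]
  exact isOpenMap_tgt _ (hU.preimage AmpleGroupoid.continuous_inv)

theorem finite_src {f : ArrowMap O} (hf : f ∈ gammaSubgroup O) (x : X) :
    {γ : Arr X | γ.src = x ∧ f γ ≠ 0}.Finite := by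
  induction hf using AddSubgroup.closure_induction with
  | mem f hf =>
    obtain ⟨U, hU, -, h0⟩ := hf
    refine Set.Subsingleton.finite ?_
    rintro γ ⟨h1, h2⟩ δ ⟨h3, h4⟩
    exact hU.injOn_src (by_contra fun h => h2 (h0 γ h)) (by_contra fun h => h4 (h0 δ h))
      (h1.trans h3.symm)
  | zero => simp
  | add f g _ _ h1 h2 =>
    refine (h1.union h2).subset ?_
    rintro γ ⟨hx, h⟩
    by_contra hc
    simp only [Set.mem_union, Set.mem_ofPred_eq, hx, true_and, not_or, not_not] at hc
    exact h (by simp [hc.1, hc.2])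
  | neg f _ h => simpa using h

theorem finite_tgt {f : ArrowMap O} (hf : f ∈ gammaSubgroup O) (x : X) :
    {γ : Arr X | γ.tgt = x ∧ f γ ≠ 0}.Finite := by
  induction hf using AddSubgroup.closure_induction with
  | mem f hf =>
    obtain ⟨U, hU, -, h0⟩ := hf
    refine Set.Subsingleton.finite ?_
    rintro γ ⟨h1, h2⟩ δ ⟨h3, h4⟩
    exact hU.injOn_tgt (by_contra fun h => h2 (h0 γ h)) (by_contra fun h => h4 (h0 δ h))
      (h1.trans h3.symm)
  | zero => simp
  | add f g _ _ h1 h2 =>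
    refine (h1.union h2).subset ?_
    rintro γ ⟨hx, h⟩
    by_contra hc
    simp only [Set.mem_union, Set.mem_ofPred_eq, hx, true_and, not_or, not_not] at hc
    exact h (by simp [hc.1, hc.2])
  | neg f _ h => simpa using h

theorem finite_out {f : ArrowMap O} (hf : f ∈ gammaSubgroup O) (x : X) :
    {b : (Σ y : X, (x ⟶ y)) | f (arr b.2) ≠ 0}.Finite := by
  refine Set.Finite.of_injOn (f := fun b : (Σ y : X, (x ⟶ y)) => arr b.2) (t := {γ : Arr X | γ.src = x ∧ f γ ≠ 0})
    (fun b hb => ⟨rfl, hb⟩) ?_ (finite_src hf x)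
  rintro ⟨y, γ⟩ _ ⟨z, δ⟩ _ h
  cases h
  rfl

theorem finite_into {f : ArrowMap O} (hf : f ∈ gammaSubgroup O) (x : X) :
    {b : (Σ y : X, (y ⟶ x)) | f (arr b.2) ≠ 0}.Finite := by
  refine Set.Finite.of_injOn (f := fun b : (Σ y : X, (y ⟶ x)) => arr b.2) (t := {γ : Arr X | γ.tgt = x ∧ f γ ≠ 0})
    (fun b hb => ⟨rfl, hb⟩) ?_ (finite_tgt hf x)
  rintro ⟨y, γ⟩ _ ⟨z, δ⟩ _ h
  cases h
  rfl

theorem finite_conv {f : ArrowMap O} (hf : f ∈ gammaSubgroup O) (g : ArrowMap O) (γ : Arr X) :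
    (Function.support fun b : (Σ y : X, (y ⟶ γ.tgt)) =>
      (show O.stalk γ.tgt from f (arr b.2)) * O.act b.2 (g (arr (γ.hom ≫ Groupoid.inv b.2)))).Finite := by
  refine (finite_into hf γ.tgt).subset fun b hb h => hb ?_
  simp only [h, zero_mul]

theorem conv_add_left {f f' : ArrowMap O} (hf : f ∈ gammaSubgroup O) (hf' : f' ∈ gammaSubgroup O)
    (g : ArrowMap O) : conv (f + f') g = conv f g + conv f' g := by
  funext γ
  simp only [conv, Pi.add_apply, add_mul]
  exact finsum_add_distrib (finite_conv hf g γ) (finite_conv hf' g γ)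

theorem conv_add_right {f : ArrowMap O} (hf : f ∈ gammaSubgroup O)
    (g g' : ArrowMap O) : conv f (g + g') = conv f g + conv f g' := by
  funext γ
  simp only [conv, Pi.add_apply, map_add, mul_add]
  exact finsum_add_distrib (finite_conv hf g γ) (finite_conv hf g' γ)

theorem conv_zero_left (g : ArrowMap O) : conv 0 g = 0 := by
  funext γ
  simp [conv]

theorem conv_zero_right (f : ArrowMap O) : conv f 0 = 0 := by
  funext γ
  simp [conv]

theorem conv_neg_left (f g : ArrowMap O) : conv (-f) g = - conv f g := by
  funext γ
  simp [conv, finsum_neg_distrib]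

theorem conv_neg_right (f g : ArrowMap O) : conv f (-g) = - conv f g := by
  funext γ
  simp [conv, finsum_neg_distrib]

end Finiteness

/-! #### The convolution of functions supported on compact open bisections -/

section Convolution

theorem conv_apply_of_injOn_tgt {f : ArrowMap O} {U : Set (Arr X)} (hU : Set.InjOn Arr.tgt U)
    (hf : ∀ γ, γ ∉ U → f γ = 0) (g : ArrowMap O) {x y z : X} (γ : x ⟶ y) (β : y ⟶ z)
    (hβ : arr β ∈ U) :
    conv f g (arr (γ ≫ β)) = f (arr β) * O.act β (g (arr γ)) := by
  unfold conv
  rw [finsum_eq_single _ (⟨y, β⟩ : Σ y : X, (y ⟶ z))]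
  · have key : ∀ h : x ⟶ y, h = γ → O.act β (g (arr h)) = O.act β (g (arr γ)) := by
      rintro _ rfl
      rfl
    exact congrArg (f (arr β) * ·) (key _ (by simp))
  · rintro ⟨y', β'⟩ h
    by_cases h' : arr β' ∈ U
    · have := hU h' hβ rfl
      cases this
      exact absurd rfl h
    · simp only [hf _ h', zero_mul]

/-- The product `UV` of two sets of arrows. -/
def mulSet (U V : Set (Arr X)) : Set (Arr X) :=
  {δ | ∃ p : ComposablePair X, arr p.snd ∈ U ∧ arr p.fst ∈ V ∧ arr (p.fst ≫ p.snd) = δ}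

theorem conv_eq_zero {f g : ArrowMap O} {U V : Set (Arr X)}
    (hf : ∀ γ, γ ∉ U → f γ = 0) (hg : ∀ γ, γ ∉ V → g γ = 0) (δ : Arr X)
    (hδ : δ ∉ mulSet U V) : conv f g δ = 0 := by
  unfold conv
  rw [finsum_eq_zero_of_forall_eq_zero]
  rintro ⟨y, β⟩
  by_cases h1 : arr β ∈ U
  · by_cases h2 : arr (δ.hom ≫ Groupoid.inv β) ∈ V
    · exact absurd ⟨⟨δ.src, y, δ.tgt, δ.hom ≫ Groupoid.inv β, β⟩, h1, h2, by simp⟩ hδ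
    · simp only [hg _ h2, map_zero, mul_zero]
  · simp only [hf _ h1, zero_mul]

theorem continuous_pairFst : Continuous fun p : ComposablePair X => arr p.fst :=
  continuous_fst.comp
    (continuous_induced_dom (f := fun p : ComposablePair X => (arr p.fst, arr p.snd)))

theorem continuous_pairSnd : Continuous fun p : ComposablePair X => arr p.snd :=
  continuous_snd.comp
    (continuous_induced_dom (f := fun p : ComposablePair X => (arr p.fst, arr p.snd)))

theorem ComposablePair.ext' {p q : ComposablePair X} (h1 : arr p.fst = arr q.fst)
    (h2 : arr p.snd = arr q.snd) : p = q := by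
  cases p; cases q
  cases h1
  cases h2
  rfl

theorem isClosedEmbedding_pair :
    IsClosedEmbedding fun p : ComposablePair X => (arr p.fst, arr p.snd) := by
  refine ⟨⟨⟨rfl⟩, fun p q h => ComposablePair.ext' (congrArg Prod.fst h) (congrArg Prod.snd h)⟩, ?_⟩
  have : (Set.range fun p : ComposablePair X => (arr p.fst, arr p.snd)) =
      {q : Arr X × Arr X | q.1.tgt = q.2.src} := by
    ext ⟨⟨a, b, γ⟩, ⟨c, d, β⟩⟩
    constructor
    · rintro ⟨p, hp⟩
      cases hp
      rfl
    · intro h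
      obtain rfl : b = c := h
      exact ⟨⟨a, b, d, γ, β⟩, rfl⟩
  rw [this]
  exact isClosed_eq (AmpleGroupoid.continuous_tgt.comp continuous_fst)
    (AmpleGroupoid.continuous_src.comp continuous_snd)

theorem isOpen_mulSet {U V : Set (Arr X)} (hU : IsCompactOpenBisection U) (hV : IsOpen V) :
    IsOpen (mulSet U V) := by
  rw [isOpen_iff_mem_nhds]
  rintro _ ⟨p₀, h1, h2, rfl⟩
  obtain ⟨σ, hσ, hc⟩ := exists_section_of_isOpenMap isOpenMap_tgt hU.isOpen hU.injOn_tgt ⟨arr p₀.fst⟩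
  set A : Set (Arr X) := Arr.tgt ⁻¹' (Arr.tgt '' U) with hA
  have hAo : IsOpen A := (isOpenMap_tgt _ hU.isOpen).preimage AmpleGroupoid.continuous_tgt
  have hσA : ∀ δ ∈ A, σ δ.tgt ∈ U ∧ (σ δ.tgt).tgt = δ.tgt := by
    rintro δ ⟨u, hu, h⟩
    rw [← h, hσ u hu]
    exact ⟨hu, rfl⟩
  let κ : A → ComposablePair X := fun δ =>
    ⟨δ.1.src, δ.1.tgt, (σ δ.1.tgt).src, δ.1.hom,
      eqToHom (hσA δ.1 δ.2).2.symm ≫ Groupoid.inv (σ δ.1.tgt).hom⟩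
  have hκ2 : ∀ δ : A, arr (κ δ).snd = arr (Groupoid.inv (σ δ.1.tgt).hom) := by
    intro δ
    have h := (hσA δ.1 δ.2).2
    have key : ∀ (b : X) (τ : Arr X) (h : τ.tgt = b),
        arr (eqToHom h.symm ≫ Groupoid.inv τ.hom) = arr (Groupoid.inv τ.hom) := by
      rintro b τ rfl
      simp
    exact key _ _ h
  have hκ : Continuous κ := by
    rw [continuous_induced_rng]
    refine Continuous.prodMk continuous_subtype_val ?_
    have : (fun δ : A => arr (κ δ).snd) = fun δ : A => arr (Groupoid.inv (σ δ.1.tgt).hom) :=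
      funext hκ2
    show Continuous (fun δ : A => arr (κ δ).snd)
    rw [this]
    refine AmpleGroupoid.continuous_inv.comp ?_
    have h3 : ContinuousOn (fun δ : Arr X => σ δ.tgt) A :=
      hc.comp AmpleGroupoid.continuous_tgt.continuousOn fun δ hδ => hδ
    exact h3.domRestrict
  have hopen : IsOpen (Subtype.val '' {δ : A | arr ((κ δ).fst ≫ (κ δ).snd) ∈ V}) :=
    hAo.isOpenMap_subtype_val _ (hV.preimage (AmpleGroupoid.continuous_comp.comp hκ))
  have hval : ∀ δ : A, ∃ (x y z : X) (γ : x ⟶ y) (β : z ⟶ y), arr γ = δ.1 ∧ arr β = σ δ.1.tgt ∧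
      arr ((κ δ).fst ≫ (κ δ).snd) = arr (γ ≫ Groupoid.inv β) := by
    rintro ⟨δ, hδ⟩
    have h := (hσA δ hδ).2
    have key : ∀ (τ : Arr X) (h : τ.tgt = δ.tgt), ∃ (x y z : X) (γ : x ⟶ y) (β : z ⟶ y),
        arr γ = δ ∧ arr β = τ ∧
        arr (δ.hom ≫ eqToHom h.symm ≫ Groupoid.inv τ.hom) = arr (γ ≫ Groupoid.inv β) := by
      rintro ⟨a, b, τ⟩ h
      obtain rfl : b = δ.tgt := h
      exact ⟨_, _, _, δ.hom, τ, rfl, rfl, by simp⟩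
    exact key _ h
  refine Filter.mem_of_superset (hopen.mem_nhds ?_) ?_
  · refine ⟨⟨arr (p₀.fst ≫ p₀.snd), ⟨arr p₀.snd, h1, rfl⟩⟩, ?_, rfl⟩
    obtain ⟨x, y, z, γ, β, e1, e2, e3⟩ := hval ⟨arr (p₀.fst ≫ p₀.snd), ⟨arr p₀.snd, h1, rfl⟩⟩
    rw [Set.mem_ofPred_eq, e3]
    have e4 : arr β = arr p₀.snd := e2.trans (hσ _ h1)
    cases e4
    cases e1
    simpa using h2
  · rintro _ ⟨δ, hδ, rfl⟩
    obtain ⟨x, y, z, γ, β, e1, e2, e3⟩ := hval δ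
    rw [Set.mem_ofPred_eq, e3] at hδ
    refine ⟨⟨x, z, y, γ ≫ Groupoid.inv β, β⟩, ?_, hδ, ?_⟩
    · show arr β ∈ U
      rw [e2]
      exact (hσA δ.1 δ.2).1
    · rw [← e1]
      simp

theorem isCompactOpenBisection_mulSet {U V : Set (Arr X)} (hU : IsCompactOpenBisection U)
    (hV : IsCompactOpenBisection V) : IsCompactOpenBisection (mulSet U V) where
  isOpen := isOpen_mulSet hU hV.isOpen
  isCompact := by
    have h : mulSet U V = (fun p : ComposablePair X => arr (p.fst ≫ p.snd)) ''
        ((fun p : ComposablePair X => (arr p.fst, arr p.snd)) ⁻¹' (V ×ˢ U)) := by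
      ext δ
      constructor
      · rintro ⟨p, h1, h2, h3⟩
        exact ⟨p, ⟨h2, h1⟩, h3⟩
      · rintro ⟨p, ⟨h2, h1⟩, h3⟩
        exact ⟨p, h1, h2, h3⟩
    rw [h]
    exact (isClosedEmbedding_pair.isCompact_preimage (hV.isCompact.prod hU.isCompact)).image
      AmpleGroupoid.continuous_comp
  injOn_src := by
    rintro _ ⟨p, h1, h2, rfl⟩ _ ⟨q, h3, h4, rfl⟩ h
    have e1 := hV.injOn_src h2 h4 h
    have e2 := hU.injOn_src h1 h3 (congrArg Arr.tgt e1 :)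
    rw [ComposablePair.ext' e1 e2]
  injOn_tgt := by
    rintro _ ⟨p, h1, h2, rfl⟩ _ ⟨q, h3, h4, rfl⟩ h
    have e2 := hU.injOn_tgt h1 h3 h
    have e1 := hV.injOn_tgt h2 h4 (congrArg Arr.src e2 :)
    rw [ComposablePair.ext' e1 e2]

theorem supportedOn_conv {f g : ArrowMap O} {U V : Set (Arr X)} (hU : IsCompactOpenBisection U)
    (hV : IsCompactOpenBisection V) (hf : SupportedOn f U) (hg : SupportedOn g V) :
    SupportedOn (conv f g) (mulSet U V) := by
  refine ⟨?_, conv_eq_zero hf.2 hg.2⟩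
  rcases isEmpty_or_nonempty (Arr X) with hE | hne
  · intro γ
    exact hE.elim γ
  obtain ⟨σ, hσ, hσc⟩ := exists_section_of_isOpenMap isOpenMap_tgt hU.isOpen hU.injOn_tgt hne
  obtain ⟨τ, hτ, hτc⟩ := exists_section_of_isOpenMap isOpenMap_src hV.isOpen hV.injOn_src hne
  have hex : ∀ δ : mulSet U V, ∃ p : ComposablePair X,
      arr p.snd ∈ U ∧ arr p.fst ∈ V ∧ arr (p.fst ≫ p.snd) = δ.1 := fun δ => δ.2
  choose P hP1 hP2 hP3 using hex
  have hPσ : ∀ δ, arr (P δ).snd = σ δ.1.tgt := by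
    intro δ
    rw [← hσ _ (hP1 δ)]
    exact congrArg σ (congrArg Arr.tgt (hP3 δ) :)
  have hPτ : ∀ δ, arr (P δ).fst = τ δ.1.src := by
    intro δ
    rw [← hτ _ (hP2 δ)]
    exact congrArg τ (congrArg Arr.src (hP3 δ) :)
  have hs : Continuous fun δ : mulSet U V => arr (P δ).snd := by
    rw [funext hPσ]
    have h3 : ContinuousOn (fun δ : Arr X => σ δ.tgt) (mulSet U V) := by
      refine hσc.comp AmpleGroupoid.continuous_tgt.continuousOn ?_
      rintro _ ⟨p, h1, h2, rfl⟩
      exact ⟨_, h1, rfl⟩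
    exact h3.domRestrict
  have ht : Continuous fun δ : mulSet U V => arr (P δ).fst := by
    rw [funext hPτ]
    have h3 : ContinuousOn (fun δ : Arr X => τ δ.src) (mulSet U V) := by
      refine hτc.comp AmpleGroupoid.continuous_src.continuousOn ?_
      rintro _ ⟨p, h1, h2, rfl⟩
      exact ⟨_, h2, rfl⟩
    exact h3.domRestrict
  have hval : ∀ δ : mulSet U V, (⟨δ.1.tgt, conv f g δ.1⟩ : Total O.stalk) =
      ⟨(P δ).tgt, f (arr (P δ).snd) * O.act (P δ).snd (g (arr (P δ).fst))⟩ := by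
    intro δ
    rw [← conv_apply_of_injOn_tgt hU.injOn_tgt hf.2 g (P δ).fst (P δ).snd (hP1 δ)]
    exact congrArg (fun γ : Arr X => (⟨γ.tgt, conv f g γ⟩ : Total O.stalk)) (hP3 δ).symm
  rw [continuousOn_iff_continuous_domRestrict]
  have : (mulSet U V).domRestrict (fun γ => (⟨γ.tgt, conv f g γ⟩ : Total O.stalk)) =
      fun δ : mulSet U V =>
      ⟨(P δ).tgt, f (arr (P δ).snd) * O.act (P δ).snd (g (arr (P δ).fst))⟩ := funext hval
  rw [this]
  have hF : Continuous fun δ : mulSet U V =>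
      (⟨(P δ).tgt, f (arr (P δ).snd)⟩ : Total O.stalk) :=
    hf.1.comp_continuous hs hP1
  have hG : Continuous fun δ : mulSet U V =>
      (⟨(P δ).mid, g (arr (P δ).fst)⟩ : Total O.stalk) :=
    hg.1.comp_continuous ht hP2
  have hA : Continuous fun δ : mulSet U V =>
      (⟨arr (P δ).snd, g (arr (P δ).fst)⟩ : ActPair O.stalk) := by
    rw [continuous_induced_rng]
    exact hs.prodMk hG
  have hB : Continuous fun δ : mulSet U V =>
      (⟨(P δ).tgt, f (arr (P δ).snd), O.act (P δ).snd (g (arr (P δ).fst))⟩ :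
        FiberProd O.stalk O.stalk) := by
    rw [continuous_induced_rng]
    exact hF.prodMk (O.continuous_act.comp hA)
  exact O.continuous_mul.comp hB

theorem conv_mem {f g : ArrowMap O} (hf : f ∈ gammaSubgroup O) (hg : g ∈ gammaSubgroup O) :
    conv f g ∈ gammaSubgroup O := by
  induction hf using AddSubgroup.closure_induction with
  | mem f hf =>
    have hf' : f ∈ gammaSubgroup O := AddSubgroup.subset_closure hf
    obtain ⟨U, hU, hfU⟩ := hf
    induction hg using AddSubgroup.closure_induction with
    | mem g hg =>
      obtain ⟨V, hV, hgV⟩ := hg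
      exact AddSubgroup.subset_closure
        ⟨_, isCompactOpenBisection_mulSet hU hV, supportedOn_conv hU hV hfU hgV⟩
    | zero => rw [conv_zero_right]; exact zero_mem _
    | add g g' _ _ h1 h2 => rw [conv_add_right hf']; exact add_mem h1 h2
    | neg g _ h => rw [conv_neg_right]; exact neg_mem h
  | zero => rw [conv_zero_left]; exact zero_mem _
  | add f f' h h' h1 h2 => rw [conv_add_left h h']; exact add_mem h1 h2
  | neg f _ h => rw [conv_neg_left]; exact neg_mem h

end Convolution

/-! #### The module `ℒ_x` and the two actions on it -/

variable (O)

/-- `ℒ_x = ⨁_{d(γ) = x} 𝒪_{r(γ)}`. -/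
abbrev LMod (x : X) : Type (max u v w) := ⨁ γ : (Σ y : X, (x ⟶ y)), O.stalk γ.1

/-- The element `a1_γ` of `ℒ_x`. -/
def lsingle {x y : X} (γ : x ⟶ y) : O.stalk y →+ LMod O x :=
  DirectSum.of (fun γ : (Σ y : X, (x ⟶ y)) => O.stalk γ.1) ⟨y, γ⟩

variable {O}

theorem lmod_hom_ext {x : X} {A : Type*} [AddCommMonoid A] {φ ψ : LMod O x →+ A}
    (h : ∀ (y : X) (γ : x ⟶ y) (a : O.stalk y), φ (lsingle O γ a) = ψ (lsingle O γ a)) : φ = ψ := by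
  refine DirectSum.addHom_ext ?_
  rintro ⟨y, γ⟩ a
  exact h y γ a

/-- The map `ℒ_y → ℒ_x`, `b1_β ↦ b1_β · aγ = b α_β(a) 1_{βγ}`, for `γ : x → y` and `a ∈ 𝒪_y`.
For `y = x` this is the right action of `aγ ∈ B_x`. -/
def rmul {x y : X} (γ : x ⟶ y) (a : O.stalk y) : LMod O y →+ LMod O x :=
  DirectSum.toAddMonoid fun β : (Σ z : X, (y ⟶ z)) =>
    (lsingle O (γ ≫ β.2)).comp (AddMonoidHom.mulRight (O.act β.2 a))

@[simp] theorem rmul_lsingle {x y z : X} (γ : x ⟶ y) (a : O.stalk y) (β : y ⟶ z) (b : O.stalk z) :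
    rmul γ a (lsingle O β b) = lsingle O (γ ≫ β) (b * O.act β a) := by
  simp [rmul, lsingle]

theorem rmul_add {x y : X} (γ : x ⟶ y) (a b : O.stalk y) :
    rmul γ (a + b) = rmul γ a + rmul γ b := by
  refine lmod_hom_ext fun z β c => ?_
  simp [mul_add]

theorem rmul_zero {x y : X} (γ : x ⟶ y) : rmul γ (0 : O.stalk y) = 0 := by
  refine lmod_hom_ext fun z β c => ?_
  simp

theorem lsingle_congr {x y : X} {γ δ : x ⟶ y} (h : γ = δ) (a : O.stalk y) :
    lsingle O γ a = lsingle O δ a := by rw [h]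

theorem rmul_rmul {x y z : X} (δ : x ⟶ y) (b : O.stalk y) (γ : y ⟶ z) (a : O.stalk z)
    (ξ : LMod O z) : rmul δ b (rmul γ a ξ) = rmul (δ ≫ γ) (a * O.act γ b) ξ := by
  suffices h : (rmul δ b).comp (rmul γ a) = rmul (δ ≫ γ) (a * O.act γ b) from
    DFunLike.congr_fun h ξ
  refine lmod_hom_ext fun w β c => ?_
  simp [O.act_comp, mul_assoc]

theorem rmul_id {x : X} (ξ : LMod O x) : rmul (𝟙 x) 1 ξ = ξ := by
  suffices h : rmul (𝟙 x) (1 : O.stalk x) = AddMonoidHom.id _ from DFunLike.congr_fun h ξ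
  refine lmod_hom_ext fun w β c => ?_
  simp

/-- The finitely supported restriction of `f` to `d⁻¹(x)`, `∑_{d(β) = x} f(β) 1_β ∈ ℒ_x`. -/
def restrictFiber (f : Gamma O) (x : X) : LMod O x :=
  DFinsupp.mk (finite_out f.2 x).toFinset fun β => f (arr β.1.2)

theorem restrictFiber_apply (f : Gamma O) (x : X) (β : (Σ y : X, (x ⟶ y))) :
    restrictFiber f x β = f (arr β.2) := by
  unfold restrictFiber
  rw [DFinsupp.mk_apply]
  split_ifs with h
  · rfl
  · simp only [Set.Finite.mem_toFinset, Set.mem_ofPred_eq, not_not] at h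
    exact h.symm

theorem restrictFiber_add (f g : Gamma O) (x : X) :
    restrictFiber (f + g) x = restrictFiber f x + restrictFiber g x := by
  refine DFinsupp.ext fun β => ?_
  rw [DFinsupp.add_apply, restrictFiber_apply, restrictFiber_apply, restrictFiber_apply]
  rfl

theorem restrictFiber_injective {f g : Gamma O} (h : ∀ x, restrictFiber f x = restrictFiber g x) :
    f = g := by
  refine Subtype.ext (funext fun γ => ?_)
  have := DFunLike.congr_fun (h γ.src) ⟨γ.tgt, γ.hom⟩
  rwa [restrictFiber_apply, restrictFiber_apply] at this

/-- The left action of `f` on `ℒ_x`, `f · a1_γ = ∑_{d(β) = r(γ)} f(β) α_β(a) 1_{βγ}`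
(see `lmul_lsingle_eq_finsum`). -/
def lmul (x : X) (f : Gamma O) : LMod O x →+ LMod O x :=
  DirectSum.toAddMonoid fun γ : (Σ y : X, (x ⟶ y)) =>
    { toFun := fun a => rmul γ.2 a (restrictFiber f γ.1)
      map_zero' := by simp [rmul_zero]
      map_add' := fun a b => by simp [rmul_add] }

theorem lmul_lsingle (f : Gamma O) {x y : X} (γ : x ⟶ y) (a : O.stalk y) :
    lmul x f (lsingle O γ a) = rmul γ a (restrictFiber f y) := by
  simp [lmul, lsingle]

theorem restrictFiber_eq_finsum (f : Gamma O) (x : X) :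
    restrictFiber f x = ∑ᶠ β : (Σ y : X, (x ⟶ y)), lsingle O β.2 (f (arr β.2)) := by
  rw [finsum_eq_sum_of_support_subset (s := (restrictFiber f x).support)]
  · conv_lhs => rw [← DirectSum.sum_support_of (restrictFiber f x)]
    refine Finset.sum_congr rfl fun β _ => ?_
    rw [restrictFiber_apply]
    rfl
  · intro β hβ
    rw [Finset.mem_coe, DFinsupp.mem_support_iff, restrictFiber_apply]
    intro h
    exact hβ (by simp only [h, map_zero])

theorem lmul_lsingle_eq_finsum (f : Gamma O) {x y : X} (γ : x ⟶ y) (a : O.stalk y) :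
    lmul x f (lsingle O γ a) =
      ∑ᶠ β : (Σ z : X, (y ⟶ z)), lsingle O (γ ≫ β.2) (f (arr β.2) * O.act β.2 a) := by
  rw [lmul_lsingle, restrictFiber_eq_finsum, AddMonoidHom.map_finsum]
  · simp
  · refine (finite_out f.2 y).subset fun β hβ h => hβ ?_
    simp only [h, map_zero]

theorem lsingle_apply_self {x y : X} (γ : x ⟶ y) (a : O.stalk y) :
    lsingle O γ a ⟨y, γ⟩ = a :=
  DirectSum.of_eq_same _ _

theorem lsingle_apply_ne {x y z : X} (γ : x ⟶ y) (a : O.stalk y) (δ : x ⟶ z)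
    (h : (⟨y, γ⟩ : Σ y : X, (x ⟶ y)) ≠ ⟨z, δ⟩) : lsingle O γ a ⟨z, δ⟩ = 0 :=
  DirectSum.of_eq_of_ne _ _ _ h.symm

theorem rmul_apply {x y z : X} (γ : x ⟶ y) (a : O.stalk y) (ζ : LMod O y) (β : y ⟶ z) :
    rmul γ a ζ ⟨z, γ ≫ β⟩ = ζ ⟨z, β⟩ * O.act β a := by
  induction ζ using DirectSum.induction_on with
  | zero => simp
  | of i c =>
    obtain ⟨w, δ⟩ := i
    change rmul γ a (lsingle O δ c) _ = lsingle O δ c _ * _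
    rw [rmul_lsingle]
    by_cases h : (⟨w, δ⟩ : Σ y' : X, (y ⟶ y')) = ⟨z, β⟩
    · cases h
      rw [lsingle_apply_self, lsingle_apply_self]
    · rw [lsingle_apply_ne _ _ _ h, zero_mul, lsingle_apply_ne]
      intro h'
      apply h
      obtain rfl : w = z := congrArg Sigma.fst h'
      have h2 : γ ≫ δ = γ ≫ β := by simpa using h'
      rw [(cancel_epi γ).1 h2]
  | add ζ ζ' h h' => 
    rw [map_add, DirectSum.add_apply, DirectSum.add_apply, h, h', add_mul]

theorem finite_lmul {f : ArrowMap O} (hf : f ∈ gammaSubgroup O) {z : X}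
    (φ : ∀ b : (Σ y : X, (y ⟶ z)), O.stalk b.1) :
    (Function.support fun b : (Σ y : X, (y ⟶ z)) =>
      (show O.stalk z from f (arr b.2)) * O.act b.2 (φ b)).Finite := by
  refine (finite_into hf z).subset fun b hb h => hb ?_
  simp only [h, zero_mul]

theorem lmul_apply (f : Gamma O) {x z : X} (ξ : LMod O x) (δ : x ⟶ z) :
    lmul x f ξ ⟨z, δ⟩ = ∑ᶠ b : (Σ y : X, (y ⟶ z)),
      (show O.stalk z from f (arr b.2)) * O.act b.2 (ξ ⟨b.1, δ ≫ Groupoid.inv b.2⟩) := by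
  induction ξ using DirectSum.induction_on with
  | zero => simp
  | of i a =>
    obtain ⟨y, γ⟩ := i
    change lmul x f (lsingle O γ a) _ = _
    rw [lmul_lsingle]
    obtain ⟨β, rfl⟩ : ∃ β : y ⟶ z, δ = γ ≫ β := ⟨Groupoid.inv γ ≫ δ, by simp⟩
    rw [rmul_apply, restrictFiber_apply]
    rw [finsum_eq_single _ (⟨y, β⟩ : Σ y : X, (y ⟶ z))]
    · have key : ∀ h : x ⟶ y, h = γ → lsingle O γ a ⟨y, h⟩ = a := by
        rintro _ rfl
        exact lsingle_apply_self _ _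
      exact congrArg (fun c => (show O.stalk z from f (arr β)) * O.act β c) (key ((γ ≫ β) ≫ Groupoid.inv β) (by simp)).symm
    · rintro ⟨y', β'⟩ h
      have : lsingle O γ a ⟨y', (γ ≫ β) ≫ Groupoid.inv β'⟩ = 0 := by
        refine lsingle_apply_ne _ _ _ fun h' => h ?_
        obtain rfl : y = y' := congrArg Sigma.fst h'
        have h2 : γ = (γ ≫ β) ≫ Groupoid.inv β' := by simpa using h'
        have h3 : γ ≫ β' = γ ≫ β := by
          conv_lhs => rw [h2]
          simp
        rw [(cancel_epi γ).1 h3]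
      exact (congrArg (fun c => (show O.stalk z from f (arr β')) * O.act β' c) this).trans
        (by simp)
  | add ξ ξ' h h' =>
    rw [map_add, DirectSum.add_apply, h, h',
      ← finsum_add_distrib (finite_lmul f.2 _) (finite_lmul f.2 _)]
    simp [mul_add]

theorem lmul_rmul (f : Gamma O) {x y : X} (γ : x ⟶ y) (a : O.stalk y) (ξ : LMod O y) :
    lmul x f (rmul γ a ξ) = rmul γ a (lmul y f ξ) := by
  suffices h : (lmul x f).comp (rmul γ a) = (rmul γ a).comp (lmul y f) from DFunLike.congr_fun h ξ
  refine lmod_hom_ext fun z β b => ?_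
  simp [lmul_lsingle, rmul_rmul]

theorem lmul_add (x : X) (f g : Gamma O) : lmul x (f + g) = lmul x f + lmul x g := by
  refine lmod_hom_ext fun z β b => ?_
  simp [lmul_lsingle, restrictFiber_add]

instance : Mul (Gamma O) := ⟨fun f g => ⟨conv f g, conv_mem f.2 g.2⟩⟩

theorem restrictFiber_mul (f g : Gamma O) (x : X) :
    restrictFiber (f * g) x = lmul x f (restrictFiber g x) := by
  refine DFinsupp.ext ?_
  rintro ⟨z, δ⟩
  rw [restrictFiber_apply, lmul_apply]
  simp only [restrictFiber_apply]
  rfl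

theorem lmul_mul (x : X) (f g : Gamma O) (ξ : LMod O x) :
    lmul x (f * g) ξ = lmul x f (lmul x g ξ) := by
  suffices h : lmul x (f * g) = (lmul x f).comp (lmul x g) from DFunLike.congr_fun h ξ
  refine lmod_hom_ext fun z β b => ?_
  simp [lmul_lsingle, restrictFiber_mul, lmul_rmul]

/-- `Γ_c(𝒢, 𝒪)` is a ring (in general without unit) under convolution. -/
instance : NonUnitalRing (Gamma O) :=
  { (inferInstance : AddCommGroup (Gamma O)), (inferInstance : Mul (Gamma O)) with
    left_distrib := fun f g h => Subtype.ext (conv_add_right f.2 g.1 h.1)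
    right_distrib := fun f g h => Subtype.ext (conv_add_left f.2 g.2 h.1)
    zero_mul := fun f => Subtype.ext (conv_zero_left f.1)
    mul_zero := fun f => Subtype.ext (conv_zero_right f.1)
    mul_assoc := fun f g h => restrictFiber_injective fun x => by
      rw [restrictFiber_mul, restrictFiber_mul, restrictFiber_mul, lmul_mul] }

/-! ### Isotropy skew group rings and induced modules -/

/-- The isotropy group `𝒢ₓˣ` acts on `𝒪_x` through `α`. -/
instance isotropyAction (x : X) : MulSemiringAction (End x) (O.stalk x) where
  smul δ a := O.act δ a
  one_smul a := O.act_id x a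
  mul_smul β γ a := (O.act_comp γ β a).symm
  smul_zero δ := map_zero (O.act δ)
  smul_add δ := map_add (O.act δ)
  smul_one δ := map_one (O.act δ)
  smul_mul δ := map_mul (O.act δ)

variable (O)

/-- The isotropy skew group ring `B_x = 𝒪_x ⋊ 𝒢ₓˣ`; the element `bδ` is
`SkewMonoidAlgebra.single δ b`. -/
abbrev IsotropyRing (x : X) : Type (max v w) := SkewMonoidAlgebra (O.stalk x) (End x)

/-- The right action of `𝒪_x` on `ℒ_x`, `a1_γ · b = a α_γ(b) 1_γ`. -/
def rmulScalar (x : X) : O.stalk x →+* (AddMonoid.End (LMod O x))ᵐᵒᵖ where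
  toFun b := MulOpposite.op (rmul (𝟙 x) b)
  map_one' := by
    refine congrArg MulOpposite.op (AddMonoidHom.ext fun ξ => ?_)
    exact rmul_id ξ
  map_mul' a b := by
    refine congrArg MulOpposite.op (AddMonoidHom.ext fun ξ => ?_)
    show _ = rmul (𝟙 x) b (rmul (𝟙 x) a ξ)
    rw [rmul_rmul, O.act_id, Category.comp_id]
  map_zero' := congrArg MulOpposite.op (rmul_zero _)
  map_add' a b := congrArg MulOpposite.op (rmul_add _ a b)

/-- The right action of `𝒢ₓˣ` on `ℒ_x`, `a1_γ · δ = a 1_{γδ}`. -/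
def rmulIsotropy (x : X) : End x →* (AddMonoid.End (LMod O x))ᵐᵒᵖ where
  toFun δ := MulOpposite.op (rmul (End.asHom δ) 1)
  map_one' := by
    refine congrArg MulOpposite.op (AddMonoidHom.ext fun ξ => ?_)
    exact rmul_id ξ
  map_mul' β γ := by
    refine congrArg MulOpposite.op (AddMonoidHom.ext fun ξ => ?_)
    show rmul (End.asHom γ ≫ End.asHom β) 1 ξ = rmul (End.asHom γ) 1 (rmul (End.asHom β) 1 ξ)
    rw [rmul_rmul, map_one, mul_one]

/-- The right action of `B_x` on `ℒ_x` as a ring homomorphism to the opposite of the endomorphism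
ring of `ℒ_x`; `bδ` acts by first `b`, then `δ`. -/
def rmulHom (x : X) : IsotropyRing O x →+* (AddMonoid.End (LMod O x))ᵐᵒᵖ :=
  SkewMonoidAlgebra.liftNCRingHom (rmulScalar O x) (rmulIsotropy O x) (by
    intro b δ
    refine congrArg MulOpposite.op (AddMonoidHom.ext fun ξ => ?_)
    show rmul (End.asHom δ) 1 (rmul (𝟙 x) (O.act (End.asHom δ) b) ξ) =
      rmul (𝟙 x) b (rmul (End.asHom δ) 1 ξ)
    rw [rmul_rmul, rmul_rmul, map_one, mul_one, one_mul, Category.comp_id, Category.id_comp])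

/-- The right `B_x`-module structure on `ℒ_x`, `a1_γ · bδ = a α_γ(b) 1_{γδ}`. -/
instance lmodModule (x : X) : Module (IsotropyRing O x)ᵐᵒᵖ (LMod O x) where
  smul b ξ := (rmulHom O x b.unop).unop ξ
  one_smul ξ := by
    show (rmulHom O x 1).unop ξ = ξ
    rw [map_one]
    rfl
  mul_smul b c ξ := by
    show (rmulHom O x (c.unop * b.unop)).unop ξ = _
    rw [map_mul]
    rfl
  smul_zero b := map_zero _
  smul_add b := map_add _
  add_smul b c ξ := by
    show (rmulHom O x (b.unop + c.unop)).unop ξ = _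
    rw [map_add]
    rfl
  zero_smul ξ := by
    show (rmulHom O x 0).unop ξ = 0
    rw [map_zero]
    rfl

theorem op_single_smul {x : X} (δ : End x) (b : O.stalk x) (ξ : LMod O x) :
    MulOpposite.op (SkewMonoidAlgebra.single δ b : IsotropyRing O x) • ξ =
      rmul (End.asHom δ) b ξ := by
  have h : rmulHom O x (SkewMonoidAlgebra.single δ b) = rmulScalar O x b * rmulIsotropy O x δ :=
    SkewMonoidAlgebra.liftNC_single _ _ _ _
  show (rmulHom O x (SkewMonoidAlgebra.single δ b)).unop ξ = _
  rw [h]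
  show rmul (End.asHom δ) 1 (rmul (𝟙 x) b ξ) = _
  rw [rmul_rmul, map_one, mul_one, Category.comp_id]

theorem op_single_smul_lsingle {x y : X} (γ : x ⟶ y) (a : O.stalk y) (δ : End x) (b : O.stalk x) :
    MulOpposite.op (SkewMonoidAlgebra.single δ b : IsotropyRing O x) • lsingle O γ a =
      lsingle O (End.asHom δ ≫ γ) (a * O.act γ b) := by
  rw [op_single_smul, rmul_lsingle]

theorem lmul_op_smul {x : X} (f : Gamma O) (b : IsotropyRing O x) (ξ : LMod O x) :
    lmul x f (MulOpposite.op b • ξ) = MulOpposite.op b • lmul x f ξ := by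
  induction b using SkewMonoidAlgebra.induction_on with
  | zero => simp
  | single δ b => rw [op_single_smul, op_single_smul, lmul_rmul]
  | add b c hb hc => rw [MulOpposite.op_add, add_smul, add_smul, map_add, hb, hc]

/-- The subgroup of the tensor product of abelian groups generated by the elements
`(ξ · b) ⊗ m - ξ ⊗ (b · m)`. -/
def balancedSubgroup (B : Type*) (L : Type*) (M : Type*) [Ring B] [AddCommGroup L] [Module Bᵐᵒᵖ L]
    [AddCommGroup M] [Module B M] : AddSubgroup (L ⊗[ℤ] M) :=
  AddSubgroup.closure {t | ∃ (ξ : L) (b : B) (m : M),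
    t = (MulOpposite.op b • ξ) ⊗ₜ[ℤ] m - ξ ⊗ₜ[ℤ] (b • m)}

/-- The tensor product `L ⊗_B M` of a right module and a left module over a ring. -/
abbrev BalancedTensor (B : Type*) (L : Type*) (M : Type*) [Ring B] [AddCommGroup L] [Module Bᵐᵒᵖ L]
    [AddCommGroup M] [Module B M] :=
  (L ⊗[ℤ] M) ⧸ balancedSubgroup B L M

/-- `Ind_x(M) = ℒ_x ⊗_{B_x} M`. -/
abbrev IndModule (x : X) (M : Type z) [AddCommGroup M] [Module (IsotropyRing O x) M] :
    Type (max u v w z) :=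
  BalancedTensor (IsotropyRing O x) (LMod O x) M

/-- The left action of `f` on `Ind_x(M)`, `f · (ξ ⊗ m) = (f · ξ) ⊗ m`. -/
def indAction (x : X) (M : Type z) [AddCommGroup M] [Module (IsotropyRing O x) M] (f : Gamma O) :
    AddMonoid.End (IndModule O x M) :=
  QuotientAddGroup.map _ _ ((lmul x f).toIntLinearMap.rTensor M).toAddMonoidHom (by
    refine (AddSubgroup.closure_le _).2 ?_
    rintro _ ⟨ξ, b, m, rfl⟩
    refine AddSubgroup.subset_closure ⟨lmul x f ξ, b, m, ?_⟩
    simp [lmul_op_smul])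

theorem indAction_mk_tmul (x : X) (M : Type z) [AddCommGroup M] [Module (IsotropyRing O x) M]
    (f : Gamma O) (ξ : LMod O x) (m : M) :
    indAction O x M f (QuotientAddGroup.mk (ξ ⊗ₜ[ℤ] m)) =
      QuotientAddGroup.mk (lmul x f ξ ⊗ₜ[ℤ] m) := rfl

theorem indModule_hom_ext (x : X) (M : Type z) [AddCommGroup M] [Module (IsotropyRing O x) M]
    {φ ψ : AddMonoid.End (IndModule O x M)}
    (h : ∀ (ξ : LMod O x) (m : M), φ (QuotientAddGroup.mk (ξ ⊗ₜ[ℤ] m)) =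
      ψ (QuotientAddGroup.mk (ξ ⊗ₜ[ℤ] m))) : φ = ψ := by
  refine AddMonoidHom.ext fun t => ?_
  obtain ⟨t, rfl⟩ := QuotientAddGroup.mk_surjective t
  induction t using TensorProduct.induction_on with
  | zero => exact (map_zero φ).trans (map_zero ψ).symm
  | tmul ξ m => exact h ξ m
  | add s t hs ht =>
    exact (φ.map_add _ _).trans ((congrArg₂ (· + ·) hs ht).trans (ψ.map_add _ _).symm)

/-- The induced left `Γ_c(𝒢, 𝒪)`-module `Ind_x(M)`, given by the ring homomorphism from
`Γ_c(𝒢, 𝒪)` to the endomorphism ring of the abelian group `ℒ_x ⊗_{B_x} M`. -/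
def ind (x : X) (M : Type z) [AddCommGroup M] [Module (IsotropyRing O x) M] :
    Gamma O →ₙ+* AddMonoid.End (IndModule O x M) where
  toFun := indAction O x M
  map_mul' f g := indModule_hom_ext O x M fun ξ m => by
    rw [AddMonoid.End.coe_mul, Function.comp_apply, indAction_mk_tmul, indAction_mk_tmul, indAction_mk_tmul, lmul_mul]
  map_zero' := indModule_hom_ext O x M fun ξ m => by
    have h : lmul x (0 : Gamma O) = 0 := by simpa using lmul_add x (0 : Gamma O) 0
    rw [indAction_mk_tmul, h, AddMonoidHom.zero_apply, TensorProduct.zero_tmul]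
    rfl
  map_add' f g := indModule_hom_ext O x M fun ξ m => by
    show _ = indAction O x M f _ + indAction O x M g _
    rw [indAction_mk_tmul, indAction_mk_tmul, indAction_mk_tmul, lmul_add,
      AddMonoidHom.add_apply, TensorProduct.add_tmul]
    rfl

/-! ### Left modules over `Γ_c(𝒢, 𝒪)`

A left module over a ring `R` without unit is an abelian group `S` with a ring homomorphism `ρ` from
`R` to the endomorphism ring of `S`. -/

section NonUnitalModules

variable {R : Type*} [NonUnitalRing R] {S : Type*} [AddCommGroup S]

/-- The annihilator ideal of the left `R`-module `S` with action `ρ`. -/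
def annihilator (ρ : R →ₙ+* AddMonoid.End S) : TwoSidedIdeal R := TwoSidedIdeal.ker ρ

/-- The `R`-module `S` is simple: it is unitary (`RS = S`), non-zero, and has no submodules apart
from `0` and `S`. -/
structure IsSimpleRep (ρ : R →ₙ+* AddMonoid.End S) : Prop where
  nontrivial : Nontrivial S
  unitary : AddSubgroup.closure {s : S | ∃ (r : R) (m : S), s = ρ r m} = ⊤
  eq_bot_or_eq_top : ∀ N : AddSubgroup S, (∀ (r : R), ∀ m ∈ N, ρ r m ∈ N) → N = ⊥ ∨ N = ⊤

/-- A (left) primitive ideal: the annihilator of a simple left module. -/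
def IsPrimitiveIdeal (I : TwoSidedIdeal R) : Prop :=
  ∃ (S : Type z) (_ : AddCommGroup S) (ρ : R →ₙ+* AddMonoid.End S),
    IsSimpleRep ρ ∧ I = annihilator ρ

end NonUnitalModules

/-! ### Characteristic functions and germs -/

section Germs

variable {O}

theorem eventuallyEq_of_isLocalHomeomorph {E Y Z : Type*} [TopologicalSpace E] [TopologicalSpace Y]
    [TopologicalSpace Z] {p : E → Z} (hp : IsLocalHomeomorph p) {f g : Y → E} {y : Y}
    (hf : ContinuousAt f y) (hg : ContinuousAt g y) (h : f y = g y)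
    (hfg : ∀ᶠ t in 𝓝 y, p (f t) = p (g t)) : ∀ᶠ t in 𝓝 y, f t = g t := by
  obtain ⟨e, he, rfl⟩ := hp (f y)
  have h1 := hf.eventually (e.open_source.mem_nhds he)
  have h2 := hg.eventually (e.open_source.mem_nhds (h ▸ he))
  filter_upwards [h1, h2, hfg] with t h1 h2 h3
  exact e.injOn h1 h2 h3

theorem exists_compactOpens {V : Set X} (hV : IsOpen V) {x : X} (hx : x ∈ V) :
    ∃ K : CompactOpens X, x ∈ K ∧ (K : Set X) ⊆ V := by
  obtain ⟨K, ⟨h1, h2⟩, h3, h4⟩ :=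
    (AmpleGroupoid.isTopologicalBasis (X := X)).exists_subset_of_mem_open hx hV
  exact ⟨⟨⟨K, h2⟩, h1⟩, h3, h4⟩

theorem exists_injOn_tgt (γ : Arr X) : ∃ A : Set (Arr X), IsOpen A ∧ γ ∈ A ∧ Set.InjOn Arr.tgt A := by
  obtain ⟨e, he, h⟩ := AmpleGroupoid.isLocalHomeomorph_tgt γ
  exact ⟨e.source, e.open_source, he, h ▸ e.injOn⟩

theorem exists_injOn_src (γ : Arr X) : ∃ A : Set (Arr X), IsOpen A ∧ γ ∈ A ∧ Set.InjOn Arr.src A := by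
  obtain ⟨A, h1, h2, h3⟩ := exists_injOn_tgt (arr (Groupoid.inv γ.hom))
  refine ⟨_, h1.preimage AmpleGroupoid.continuous_inv, h2, ?_⟩
  intro δ hδ ε hε h
  have h4 := h3 hδ hε h
  have h5 := congrArg (fun γ : Arr X => arr (Groupoid.inv γ.hom)) h4
  have key : ∀ δ : Arr X, arr (Groupoid.inv (Groupoid.inv δ.hom)) = δ := fun δ => by
    rw [Groupoid.inv_eq_inv, Groupoid.inv_eq_inv, IsIso.inv_inv]
  exact (key δ).symm.trans (h5.trans (key ε))

/-- Compact open bisections form a basis. -/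
theorem exists_bisection {G : Set (Arr X)} (hG : IsOpen G) {γ : Arr X} (hγ : γ ∈ G) :
    ∃ W : Set (Arr X), IsCompactOpenBisection W ∧ γ ∈ W ∧ W ⊆ G := by
  obtain ⟨A, hA, hγA, hiA⟩ := exists_injOn_tgt γ
  obtain ⟨B, hB, hγB, hiB⟩ := exists_injOn_src γ
  set C := A ∩ B ∩ G with hC
  have hCo : IsOpen C := (hA.inter hB).inter hG
  have hiC : Set.InjOn Arr.tgt C := hiA.mono fun δ h => h.1.1
  obtain ⟨σ, hσ, hσc⟩ := exists_section_of_isOpenMap isOpenMap_tgt hCo hiC ⟨γ⟩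
  obtain ⟨K, hK, hKC⟩ := exists_compactOpens (isOpenMap_tgt _ hCo) ⟨γ, ⟨⟨hγA, hγB⟩, hγ⟩, rfl⟩
  have hW : C ∩ Arr.tgt ⁻¹' K = σ '' K := by
    ext δ
    constructor
    · rintro ⟨h1, h2⟩
      exact ⟨_, h2, hσ δ h1⟩
    · rintro ⟨x, hx, rfl⟩
      obtain ⟨δ, hδ, rfl⟩ := hKC hx
      rw [hσ δ hδ]
      exact ⟨hδ, hx⟩
  refine ⟨C ∩ Arr.tgt ⁻¹' K, ⟨?_, ?_, ?_, ?_⟩, ⟨⟨⟨hγA, hγB⟩, hγ⟩, hK⟩, fun δ h => h.1.2⟩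
  · rw [hW]
    exact K.isCompact.image_of_continuousOn (hσc.mono hKC)
  · exact hCo.inter (K.isOpen.preimage AmpleGroupoid.continuous_tgt)
  · exact hiB.mono fun δ h => h.1.1.2
  · exact hiC.mono fun δ h => h.1

theorem isOpenMap_unit : IsOpenMap (unit : X → Arr X) := by
  intro V hV
  rw [isOpen_iff_mem_nhds]
  rintro _ ⟨x, hx, rfl⟩
  obtain ⟨A, hA, hxA, hi⟩ := exists_injOn_tgt (unit x)
  have hc : Continuous fun γ : Arr X => unit γ.tgt :=
    AmpleGroupoid.continuous_unit.comp AmpleGroupoid.continuous_tgt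
  filter_upwards [hA.mem_nhds hxA, (hA.preimage hc).mem_nhds hxA,
    (hV.preimage AmpleGroupoid.continuous_tgt).mem_nhds hx] with γ h1 h2 h3
  exact ⟨γ.tgt, h3, hi h2 h1 rfl⟩

theorem isCompactOpenBisection_unit (V : CompactOpens X) :
    IsCompactOpenBisection (unit '' (V : Set X)) where
  isCompact := V.isCompact.image AmpleGroupoid.continuous_unit
  isOpen := isOpenMap_unit _ V.isOpen
  injOn_src := by
    rintro _ ⟨x, -, rfl⟩ _ ⟨y, -, rfl⟩ h
    exact congrArg unit h
  injOn_tgt := by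
    rintro _ ⟨x, -, rfl⟩ _ ⟨y, -, rfl⟩ h
    exact congrArg unit h

variable (O)

/-- The characteristic function `χ_U` of a set of arrows. -/
def chiFun (U : Set (Arr X)) : ArrowMap O := fun γ => if γ ∈ U then 1 else 0

theorem supportedOn_chiFun (U : Set (Arr X)) : SupportedOn (chiFun O U) U := by
  refine ⟨?_, fun γ h => if_neg h⟩
  refine (O.continuous_one.comp AmpleGroupoid.continuous_tgt).continuousOn.congr fun γ hγ => ?_
  simp [chiFun, hγ]

/-- `χ_U ∈ Γ_c(𝒢, 𝒪)` for a compact open bisection `U`. -/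
def chiSet (U : Set (Arr X)) (hU : IsCompactOpenBisection U) : Gamma O :=
  ⟨chiFun O U, AddSubgroup.subset_closure ⟨U, hU, supportedOn_chiFun O U⟩⟩

/-- `χ_V ∈ Γ_c(𝒢, 𝒪)` for a compact open set `V` of units. -/
def chi (V : CompactOpens X) : Gamma O := chiSet O _ (isCompactOpenBisection_unit V)

variable {O}

theorem chi_mul_apply (V : CompactOpens X) (f : Gamma O) (γ : Arr X) :
    (chi O V * f) γ = if γ.tgt ∈ V then f γ else 0 := by
  obtain ⟨x, y, γ⟩ := γ
  show conv (chiFun O (unit '' (V : Set X))) f (arr γ) = if y ∈ V then f (arr γ) else 0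
  split_ifs with h
  · have h1 := conv_apply_of_injOn_tgt (isCompactOpenBisection_unit V).injOn_tgt
      (supportedOn_chiFun O _).2 f γ (𝟙 y) ⟨y, h, rfl⟩
    have h2 : chiFun O (unit '' (V : Set X)) (arr (𝟙 y)) = 1 := if_pos ⟨y, h, rfl⟩
    rw [h2, one_mul, O.act_id] at h1
    rw [← h1]
    have key : ∀ δ : x ⟶ y, δ = γ → conv (chiFun O (unit '' (V : Set X))) f (arr γ) =
        conv (chiFun O (unit '' (V : Set X))) f (arr δ) := by
      rintro _ rfl
      rfl
    exact key _ (Category.comp_id γ)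
  · refine finsum_eq_zero_of_forall_eq_zero ?_
    rintro ⟨z, β⟩
    have : chiFun O (unit '' (V : Set X)) (arr β) = 0 := by
      refine if_neg ?_
      rintro ⟨t, ht, h'⟩
      obtain rfl : t = y := congrArg Arr.tgt h'
      exact h ht
    simp only [this, zero_mul]

theorem gamma_ext {f g : Gamma O} (h : ∀ γ : Arr X, f γ = g γ) : f = g := Subtype.ext (funext h)

theorem chi_mul_chi (V W : CompactOpens X) : chi O V * chi O W = chi O (V ⊓ W) := by
  refine gamma_ext fun γ => ?_
  rw [chi_mul_apply]
  show (if γ.tgt ∈ V then (if γ ∈ unit '' (W : Set X) then (1 : O.stalk γ.tgt) else 0) else 0) =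
    if γ ∈ unit '' ((V ⊓ W : CompactOpens X) : Set X) then 1 else 0
  by_cases h : ∃ x, unit x = γ
  · obtain ⟨x, rfl⟩ := h
    have hu : ∀ (U : Set X), unit x ∈ unit '' U ↔ x ∈ U := by
      intro U
      constructor
      · rintro ⟨y, hy, h⟩
        obtain rfl : y = x := congrArg Arr.tgt h
        exact hy
      · exact fun h => ⟨x, h, rfl⟩
    have hVW : x ∈ ((V ⊓ W : CompactOpens X) : Set X) ↔ x ∈ V ∧ x ∈ W := by
      rw [CompactOpens.coe_inf]
      rfl
    simp only [hu, hVW]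
    by_cases h1 : x ∈ V <;> by_cases h2 : x ∈ W <;> simp [h1, h2]
  · have hu : ∀ (U : Set X), γ ∉ unit '' U := by
      rintro U ⟨y, hy, h'⟩
      exact h ⟨y, h'⟩
    simp [hu]

/-- `f` is supported on a compact open bisection containing `γ` and takes the value `a` at `γ`. -/
def HasGerm (f : Gamma O) {x y : X} (γ : x ⟶ y) (a : O.stalk y) : Prop :=
  ∃ U : Set (Arr X), IsCompactOpenBisection U ∧ arr γ ∈ U ∧ SupportedOn f.1 U ∧ f (arr γ) = a

theorem hasGerm_chiSet {U : Set (Arr X)} (hU : IsCompactOpenBisection U) {x y : X} {γ : x ⟶ y}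
    (hγ : arr γ ∈ U) : HasGerm (chiSet O U hU) γ 1 :=
  ⟨U, hU, hγ, supportedOn_chiFun O U, if_pos hγ⟩

theorem hasGerm_chi {V : CompactOpens X} {x : X} (hx : x ∈ V) : HasGerm (chi O V) (𝟙 x) 1 :=
  hasGerm_chiSet _ ⟨x, hx, rfl⟩

theorem exists_hasGerm {x y : X} (γ : x ⟶ y) (a : O.stalk y) : ∃ f : Gamma O, HasGerm f γ a := by
  obtain ⟨e, he, hpe⟩ := O.isLocalHomeomorph_pt ⟨y, a⟩
  have hi : Set.InjOn Total.pt e.source := hpe ▸ e.injOn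
  obtain ⟨σ, hσ, hσc⟩ := exists_section_of_isOpenMap O.isLocalHomeomorph_pt.isOpenMap
    e.open_source hi ⟨⟨y, a⟩⟩
  set Q : Set X := Total.pt '' e.source with hQ
  have hQo : IsOpen Q := O.isLocalHomeomorph_pt.isOpenMap _ e.open_source
  have hσp : ∀ t ∈ Q, (σ t).pt = t := by
    rintro _ ⟨u, hu, rfl⟩
    rw [hσ u hu]
  obtain ⟨W, hW, hγW, hWQ⟩ := exists_bisection (hQo.preimage AmpleGroupoid.continuous_tgt)
    (γ := arr γ) ⟨_, he, rfl⟩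
  let f : ArrowMap O := fun δ =>
    if h : δ ∈ W then (hσp δ.tgt (hWQ h)) ▸ (σ δ.tgt).val else 0
  have hf : ∀ δ ∈ W, (⟨δ.tgt, f δ⟩ : Total O.stalk) = σ δ.tgt := by
    intro δ hδ
    simp only [f, hδ, dif_pos]
    have key : ∀ (t : X) (s : Total O.stalk) (h : s.pt = t),
        (⟨t, h ▸ s.val⟩ : Total O.stalk) = s := by
      rintro _ s rfl
      rfl
    exact key _ _ _
  have hfs : SupportedOn f W := by
    refine ⟨?_, fun δ hδ => dif_neg hδ⟩
    exact (hσc.comp AmpleGroupoid.continuous_tgt.continuousOn hWQ).congr hf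
  refine ⟨⟨f, AddSubgroup.subset_closure ⟨W, hW, hfs⟩⟩, W, hW, hγW, hfs, ?_⟩
  have h1 := (hf _ hγW).trans (hσ _ he)
  exact eq_of_heq (Total.mk.inj h1).2

theorem HasGerm.mul {f g : Gamma O} {x y t : X} {γ : y ⟶ t} {δ : x ⟶ y} {a : O.stalk t}
    {b : O.stalk y} (hf : HasGerm f γ a) (hg : HasGerm g δ b) :
    HasGerm (f * g) (δ ≫ γ) (a * O.act γ b) := by
  obtain ⟨U, hU, hγU, hfU, rfl⟩ := hf
  obtain ⟨V, hV, hδV, hgV, rfl⟩ := hg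
  exact ⟨mulSet U V, isCompactOpenBisection_mulSet hU hV, ⟨⟨x, y, t, δ, γ⟩, hγU, hδV, rfl⟩,
    supportedOn_conv hU hV hfU hgV, conv_apply_of_injOn_tgt hU.injOn_tgt hfU.2 g.1 δ γ hγU⟩

theorem HasGerm.congr {f : Gamma O} {x y : X} {γ δ : x ⟶ y} {a b : O.stalk y}
    (hf : HasGerm f γ a) (h : γ = δ) (h' : a = b) : HasGerm f δ b := by
  subst h
  subst h'
  exact hf

theorem SupportedOn.continuousAt {f : ArrowMap O} {U : Set (Arr X)} (h : SupportedOn f U)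
    (hU : IsOpen U) {γ : Arr X} (hγ : γ ∈ U) :
    ContinuousAt (fun γ => (⟨γ.tgt, f γ⟩ : Total O.stalk)) γ :=
  h.1.continuousAt (hU.mem_nhds hγ)

/-- Two functions with the same germ at `γ` agree over a neighbourhood of `r(γ)`. -/
theorem HasGerm.exists_chi_mul_eq {f g : Gamma O} {x y : X} {γ : x ⟶ y} {a : O.stalk y}
    (hf : HasGerm f γ a) (hg : HasGerm g γ a) :
    ∃ V : CompactOpens X, y ∈ V ∧ chi O V * f = chi O V * g := by
  obtain ⟨U, hU, hγU, hfU, hfa⟩ := hf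
  obtain ⟨U', hU', hγU', hgU, hga⟩ := hg
  have h := eventuallyEq_of_isLocalHomeomorph O.isLocalHomeomorph_pt
    (hfU.continuousAt hU.isOpen hγU) (hgU.continuousAt hU'.isOpen hγU')
    (by rw [hfa, hga]) (Filter.Eventually.of_forall fun _ => rfl)
  obtain ⟨G, hG, hGo, hγG⟩ := eventually_nhds_iff.1
    (h.and ((hU.isOpen.eventually_mem hγU).and (hU'.isOpen.eventually_mem hγU')))
  obtain ⟨V, hV, hVG⟩ := exists_compactOpens (isOpenMap_tgt _ hGo) ⟨arr γ, hγG, rfl⟩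
  refine ⟨V, hV, gamma_ext fun δ => ?_⟩
  rw [chi_mul_apply, chi_mul_apply]
  split_ifs with hδ
  · obtain ⟨ε, hε, hεδ⟩ := hVG hδ
    obtain ⟨h1, h2, h3⟩ := hG ε hε
    by_cases hd : δ = ε
    · subst hd
      exact eq_of_heq (Total.mk.inj h1).2
    · have e1 : f δ = 0 := hfU.2 δ fun h => hd (hU.injOn_tgt h h2 hεδ.symm)
      have e2 : g δ = 0 := hgU.2 δ fun h => hd (hU'.injOn_tgt h h3 hεδ.symm)
      rw [e1, e2]
  · rfl

theorem HasGerm.exists_add {f g : Gamma O} {x y : X} {γ : x ⟶ y} {a b : O.stalk y}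
    (hf : HasGerm f γ a) (hg : HasGerm g γ b) :
    ∃ V : CompactOpens X, y ∈ V ∧ HasGerm (chi O V * (f + g)) γ (a + b) := by
  obtain ⟨U, hU, hγU, hfU, rfl⟩ := hf
  obtain ⟨U', hU', hγU', hgU, rfl⟩ := hg
  obtain ⟨W, hW, hγW, hWU⟩ := exists_bisection (hU.isOpen.inter hU'.isOpen) (γ := arr γ)
    ⟨hγU, hγU'⟩
  let V : CompactOpens X :=
    ⟨⟨Arr.tgt '' W, hW.isCompact.image AmpleGroupoid.continuous_tgt⟩, isOpenMap_tgt _ hW.isOpen⟩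
  have hyV : y ∈ V := ⟨arr γ, hγW, rfl⟩
  refine ⟨V, hyV, W, hW, hγW, ⟨?_, ?_⟩, ?_⟩
  · have h1 : ContinuousOn (fun δ : Arr X =>
        (⟨δ.tgt, f δ, g δ⟩ : FiberProd O.stalk O.stalk)) W := by
      rw [continuousOn_iff_continuous_domRestrict, continuous_induced_rng]
      refine Continuous.prodMk ?_ ?_
      · exact (hfU.1.mono fun δ h => (hWU h).1).domRestrict
      · exact (hgU.1.mono fun δ h => (hWU h).2).domRestrict
    refine (O.continuous_add.comp_continuousOn h1).congr fun δ hδ => ?_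
    have : (chi O V * (f + g)).1 δ = f δ + g δ := by
      rw [chi_mul_apply, if_pos ⟨δ, hδ, rfl⟩]
      rfl
    simp only [Function.comp, this]
  · intro δ hδ
    rw [chi_mul_apply]
    split_ifs with h
    · obtain ⟨ε, hε, hεδ⟩ := h
      have hd : δ ≠ ε := fun h => hδ (h ▸ hε)
      have e1 : f δ = 0 := hfU.2 δ fun h => hd (hU.injOn_tgt h (hWU hε).1 hεδ.symm)
      have e2 : g δ = 0 := hgU.2 δ fun h => hd (hU'.injOn_tgt h (hWU hε).2 hεδ.symm)
      show f δ + g δ = 0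
      rw [e1, e2, add_zero]
    · rfl
  · rw [chi_mul_apply, if_pos hyV]
    rfl

end Germs

/-! ### The sheaf of `𝒪`-modules attached to a module -/

section Sh

variable {O} {S : Type z} [AddCommGroup S] (ρ : Gamma O →ₙ+* AddMonoid.End S)

theorem rep_mul (f g : Gamma O) (m : S) : ρ (f * g) m = ρ f (ρ g m) := by
  rw [map_mul, AddMonoid.End.coe_mul, Function.comp_apply]

theorem rep_add (f g : Gamma O) (m : S) : ρ (f + g) m = ρ f m + ρ g m := by
  rw [map_add]
  rfl

/-- `N_x = {m ∈ S | χ_V m = 0 for some compact open set V of units containing x}`. -/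
def nullGerms (x : X) : AddSubgroup S where
  carrier := {m | ∃ V : CompactOpens X, x ∈ V ∧ ρ (chi O V) m = 0}
  zero_mem' := by
    obtain ⟨V, hV, -⟩ := exists_compactOpens isOpen_univ (Set.mem_univ x)
    exact ⟨V, hV, map_zero _⟩
  add_mem' := by
    rintro m n ⟨V, hV, hm⟩ ⟨W, hW, hn⟩
    refine ⟨V ⊓ W, ?_, ?_⟩
    · show x ∈ ((V ⊓ W : CompactOpens X) : Set X)
      rw [CompactOpens.coe_inf]
      exact ⟨hV, hW⟩
    · rw [map_add]
      have h1 : ρ (chi O (V ⊓ W)) m = 0 := by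
        rw [inf_comm, ← chi_mul_chi, rep_mul, hm, map_zero]
      have h2 : ρ (chi O (V ⊓ W)) n = 0 := by
        rw [← chi_mul_chi, rep_mul, hn, map_zero]
      rw [h1, h2, add_zero]
  neg_mem' := by
    rintro m ⟨V, hV, hm⟩
    exact ⟨V, hV, by rw [map_neg, hm, neg_zero]⟩

/-- `S_x = S / N_x`. -/
abbrev GermModule (x : X) : Type z := S ⧸ nullGerms ρ x

/-- The class `[m]_x`. -/
def germ (x : X) (m : S) : GermModule ρ x := QuotientAddGroup.mk m

theorem germ_add (x : X) (m n : S) : germ ρ x (m + n) = germ ρ x m + germ ρ x n := rfl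

theorem germ_surjective {x : X} (s : GermModule ρ x) : ∃ m, germ ρ x m = s :=
  QuotientAddGroup.mk_surjective s

theorem germ_eq_zero {x : X} {m : S} :
    germ ρ x m = 0 ↔ ∃ V : CompactOpens X, x ∈ V ∧ ρ (chi O V) m = 0 :=
  QuotientAddGroup.eq_zero_iff m

theorem germ_eq {x : X} {m n : S} :
    germ ρ x m = germ ρ x n ↔ ∃ V : CompactOpens X, x ∈ V ∧ ρ (chi O V) m = ρ (chi O V) n := by
  rw [← sub_eq_zero]
  show germ ρ x (m - n) = 0 ↔ _
  rw [germ_eq_zero]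
  simp only [map_sub, sub_eq_zero]

theorem germ_chi {x : X} {V : CompactOpens X} (hx : x ∈ V) (m : S) :
    germ ρ x (ρ (chi O V) m) = germ ρ x m := by
  rw [germ_eq]
  refine ⟨V, hx, ?_⟩
  rw [← rep_mul, chi_mul_chi, inf_idem]

theorem germ_eq_of_hasGerm {x y : X} {γ : x ⟶ y} {a : O.stalk y} {f g : Gamma O}
    (hf : HasGerm f γ a) (hg : HasGerm g γ a) (m : S) : germ ρ y (ρ f m) = germ ρ y (ρ g m) := by
  obtain ⟨V, hV, h⟩ := hf.exists_chi_mul_eq hg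
  rw [germ_eq]
  exact ⟨V, hV, by rw [← rep_mul, ← rep_mul, h]⟩

theorem map_nullGerms {x y : X} {γ : x ⟶ y} {a : O.stalk y} {f : Gamma O}
    (hf : HasGerm f γ a) {m : S} (hm : m ∈ nullGerms ρ x) : ρ f m ∈ nullGerms ρ y := by
  obtain ⟨V, hV, h⟩ := hm
  have h1 : HasGerm (f * chi O V) γ a :=
    (hf.mul (hasGerm_chi hV)).congr (Category.id_comp γ) (by rw [map_one, mul_one])
  have h2 := germ_eq_of_hasGerm ρ hf h1 m
  rw [rep_mul, h, map_zero] at h2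
  exact (germ_eq_zero ρ).1 h2

/-- For `γ : x → y` and `a ∈ 𝒪_y`, the map `[m]_x ↦ [f m]_y`, where `f` is any element of
`Γ_c(𝒢, 𝒪)` that is supported on a compact open bisection containing `γ` and has `f(γ) = a`
(see `germAct_germ`). -/
def germAct {x y : X} (γ : x ⟶ y) (a : O.stalk y) : GermModule ρ x →+ GermModule ρ y :=
  QuotientAddGroup.map _ _ (ρ (exists_hasGerm γ a).choose : S →+ S)
    fun _ hm => map_nullGerms ρ (exists_hasGerm γ a).choose_spec hm

theorem germAct_germ {x y : X} {γ : x ⟶ y} {a : O.stalk y} {f : Gamma O} (hf : HasGerm f γ a)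
    (m : S) : germAct ρ γ a (germ ρ x m) = germ ρ y (ρ f m) :=
  germ_eq_of_hasGerm ρ (exists_hasGerm γ a).choose_spec hf m

theorem germAct_id (x : X) (s : GermModule ρ x) : germAct ρ (𝟙 x) 1 s = s := by
  obtain ⟨m, rfl⟩ := germ_surjective ρ s
  obtain ⟨V, hV, -⟩ := exists_compactOpens isOpen_univ (Set.mem_univ x)
  rw [germAct_germ ρ (hasGerm_chi hV), germ_chi ρ hV]

theorem germAct_germAct {x y t : X} (γ : x ⟶ y) (β : y ⟶ t) (a : O.stalk t) (b : O.stalk y)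
    (s : GermModule ρ x) :
    germAct ρ β a (germAct ρ γ b s) = germAct ρ (γ ≫ β) (a * O.act β b) s := by
  obtain ⟨m, rfl⟩ := germ_surjective ρ s
  obtain ⟨f, hf⟩ := exists_hasGerm β a
  obtain ⟨g, hg⟩ := exists_hasGerm γ b
  rw [germAct_germ ρ hg, germAct_germ ρ hf, germAct_germ ρ (hf.mul hg), rep_mul]

theorem germAct_add {x y : X} (γ : x ⟶ y) (a b : O.stalk y) (s : GermModule ρ x) :
    germAct ρ γ (a + b) s = germAct ρ γ a s + germAct ρ γ b s := by
  obtain ⟨m, rfl⟩ := germ_surjective ρ s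
  obtain ⟨f, hf⟩ := exists_hasGerm γ a
  obtain ⟨g, hg⟩ := exists_hasGerm γ b
  obtain ⟨V, hV, h⟩ := hf.exists_add hg
  rw [germAct_germ ρ hf, germAct_germ ρ hg, germAct_germ ρ h, rep_mul, germ_chi ρ hV, rep_add,
    germ_add]

theorem germAct_zero {x y : X} (γ : x ⟶ y) (s : GermModule ρ x) :
    germAct ρ γ (0 : O.stalk y) s = 0 := by
  have h := germAct_add ρ γ (0 : O.stalk y) 0 s
  rw [add_zero] at h
  exact left_eq_add.1 h

/-- The `𝒪_x`-module structure on `S_x`: `r[m]_x = [tm]_x` for a section `t` with `t(x) = r`. -/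
instance germModule (x : X) : Module (O.stalk x) (GermModule ρ x) where
  smul a s := germAct ρ (𝟙 x) a s
  one_smul s := germAct_id ρ x s
  mul_smul a b s := by
    show germAct ρ (𝟙 x) (a * b) s = germAct ρ (𝟙 x) a (germAct ρ (𝟙 x) b s)
    rw [germAct_germAct, O.act_id, Category.comp_id]
  smul_zero a := map_zero _
  smul_add a := map_add _
  add_smul a b s := germAct_add ρ _ a b s
  zero_smul s := germAct_zero ρ _ s

theorem smul_germ {x : X} {a : O.stalk x} {f : Gamma O} (hf : HasGerm f (𝟙 x) a) (m : S) :
    a • germ ρ x m = germ ρ x (ρ f m) := germAct_germ ρ hf m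

/-- The topology on `F = ∐ₓ S_x` generated by the sets `D(m, V) = {[m]_x | x ∈ V}` with `m ∈ S`
and `V` a compact open set of units. -/
instance germTopology : TopologicalSpace (Total (GermModule ρ)) :=
  TopologicalSpace.generateFrom {D | ∃ (m : S) (V : CompactOpens X),
    D = (fun x : X => (⟨x, germ ρ x m⟩ : Total (GermModule ρ))) '' (V : Set X)}

theorem isOpen_setOf_germ_eq (m n : S) : IsOpen {x : X | germ ρ x m = germ ρ x n} := by
  rw [isOpen_iff_mem_nhds]
  intro x hx
  obtain ⟨V, hV, h⟩ := (germ_eq ρ).1 hx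
  filter_upwards [V.isOpen.mem_nhds hV] with y hy
  exact (germ_eq ρ).2 ⟨V, hy, h⟩

/-- The section `x ↦ [m]_x`. -/
def germSection (m : S) (x : X) : Total (GermModule ρ) := ⟨x, germ ρ x m⟩

theorem germSection_pt (s : Total (GermModule ρ)) : ∃ m, germSection ρ m s.pt = s := by
  obtain ⟨x, s⟩ := s
  obtain ⟨m, rfl⟩ := germ_surjective ρ s
  exact ⟨m, rfl⟩

theorem germSection_eq {m n : S} {x y : X} (h : germSection ρ m x = germSection ρ n y) :
    x = y ∧ germ ρ x m = germ ρ x n := by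
  obtain rfl : x = y := congrArg Total.pt h
  exact ⟨rfl, eq_of_heq (Total.mk.inj h).2⟩

theorem continuous_germSection (m : S) : Continuous (germSection ρ m) := by
  refine continuous_generateFrom_iff.2 ?_
  rintro _ ⟨n, V, rfl⟩
  have : germSection ρ m ⁻¹' ((fun x : X => (⟨x, germ ρ x n⟩ : Total (GermModule ρ))) '' V) =
      {x : X | germ ρ x n = germ ρ x m} ∩ V := by
    ext x
    constructor
    · rintro ⟨y, hy, h⟩
      obtain ⟨rfl, h2⟩ := germSection_eq ρ (m := n) (n := m) h
      exact ⟨h2, hy⟩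
    · rintro ⟨h1, h2⟩
      exact ⟨x, h2, congrArg (Total.mk x) h1⟩
  rw [this]
  exact (isOpen_setOf_germ_eq ρ n m).inter V.isOpen

theorem isOpenMap_germSection (m : S) : IsOpenMap (germSection ρ m) := by
  intro G hG
  rw [isOpen_iff_mem_nhds]
  rintro _ ⟨x, hx, rfl⟩
  obtain ⟨V, hV, hVG⟩ := exists_compactOpens hG hx
  have h1 : IsOpen (germSection ρ m '' V) := TopologicalSpace.isOpen_generateFrom_of_mem ⟨m, V, rfl⟩
  exact Filter.mem_of_superset (h1.mem_nhds ⟨x, hV, rfl⟩) (Set.image_mono hVG)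

theorem isOpenEmbedding_germSection (m : S) : IsOpenEmbedding (germSection ρ m) :=
  .of_continuous_injective_isOpenMap (continuous_germSection ρ m)
    (fun _ _ h => (germSection_eq ρ h).1) (isOpenMap_germSection ρ m)

/-- Near `[m]_x`, every point `s` of `F` is `[m]_y` with `y = q(s)`. -/
theorem eventually_eq_germSection (m : S) (x : X) :
    ∀ᶠ s in 𝓝 (germSection ρ m x), s = germSection ρ m s.pt := by
  filter_upwards [(isOpenEmbedding_germSection ρ m).isOpen_range.mem_nhds ⟨x, rfl⟩]
  rintro _ ⟨y, rfl⟩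
  rfl

theorem isLocalHomeomorph_germ_pt :
    IsLocalHomeomorph (Total.pt : Total (GermModule ρ) → X) := by
  refine IsLocalHomeomorph.mk _ fun s => ?_
  obtain ⟨m, hm⟩ := germSection_pt ρ s
  have : Nonempty X := ⟨s.pt⟩
  refine ⟨((isOpenEmbedding_germSection ρ m).toOpenPartialHomeomorph _).symm, ?_, ?_⟩
  · simp only [OpenPartialHomeomorph.symm_source, IsOpenEmbedding.toOpenPartialHomeomorph_target]
    exact ⟨s.pt, hm⟩
  · intro t ht
    simp only [OpenPartialHomeomorph.symm_source,
      IsOpenEmbedding.toOpenPartialHomeomorph_target] at ht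
    obtain ⟨y, rfl⟩ := ht
    exact ((isOpenEmbedding_germSection ρ m).toOpenPartialHomeomorph_left_inv _).symm

theorem continuous_germ_act : Continuous fun p : ActPair (GermModule ρ) =>
    (⟨p.arrow.tgt, germAct ρ p.arrow.hom 1 p.val⟩ : Total (GermModule ρ)) := by
  rw [continuous_iff_continuousAt]
  rintro ⟨γ, s⟩
  obtain ⟨m, rfl⟩ := germ_surjective ρ s
  obtain ⟨U, hU, hγU, -⟩ := exists_bisection isOpen_univ (Set.mem_univ γ)
  have hi := continuous_induced_dom (t := inferInstance)
    (f := fun p : ActPair (GermModule ρ) =>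
      (p.arrow, (⟨p.arrow.src, p.val⟩ : Total (GermModule ρ))))
  have hc1 : Continuous fun p : ActPair (GermModule ρ) => p.arrow := continuous_fst.comp hi
  have hc2 : Continuous fun p : ActPair (GermModule ρ) =>
      (⟨p.arrow.src, p.val⟩ : Total (GermModule ρ)) := continuous_snd.comp hi
  have h1 : ∀ᶠ p in 𝓝 (⟨γ, germ ρ γ.src m⟩ : ActPair (GermModule ρ)), p.arrow ∈ U :=
    hc1.continuousAt.eventually (hU.isOpen.eventually_mem hγU)
  have h2 := (hc2.continuousAt (x := ⟨γ, germ ρ γ.src m⟩)).eventually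
    (show ∀ᶠ s in 𝓝 (⟨γ.src, germ ρ γ.src m⟩ : Total (GermModule ρ)),
      s = germSection ρ m s.pt from eventually_eq_germSection ρ m γ.src)
  have hcont : Continuous fun p : ActPair (GermModule ρ) =>
      germSection ρ (ρ (chiSet O U hU) m) p.arrow.tgt :=
    (continuous_germSection ρ _).comp (AmpleGroupoid.continuous_tgt.comp hc1)
  refine hcont.continuousAt.congr ?_
  filter_upwards [h1, h2]
  rintro ⟨δ, s⟩ h1 h2
  have h3 : s = germ ρ δ.src m := eq_of_heq (Total.mk.inj h2).2
  subst h3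
  refine congrArg (Total.mk δ.tgt) ?_
  exact (germAct_germ ρ (hasGerm_chiSet hU h1) m).symm

theorem continuous_germ_add : Continuous fun p : FiberProd (GermModule ρ) (GermModule ρ) =>
    (⟨p.pt, p.fst + p.snd⟩ : Total (GermModule ρ)) := by
  rw [continuous_iff_continuousAt]
  rintro ⟨x, s, t⟩
  obtain ⟨m, rfl⟩ := germ_surjective ρ s
  obtain ⟨n, rfl⟩ := germ_surjective ρ t
  have hi := continuous_induced_dom (t := inferInstance)
    (f := fun p : FiberProd (GermModule ρ) (GermModule ρ) =>
      ((⟨p.pt, p.fst⟩ : Total (GermModule ρ)), (⟨p.pt, p.snd⟩ : Total (GermModule ρ))))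
  have hc1 := continuous_fst.comp hi
  have hc2 := continuous_snd.comp hi
  have h1 := (hc1.continuousAt (x := ⟨x, germ ρ x m, germ ρ x n⟩)).eventually
    (eventually_eq_germSection ρ m x)
  have h2 := (hc2.continuousAt (x := ⟨x, germ ρ x m, germ ρ x n⟩)).eventually
    (eventually_eq_germSection ρ n x)
  have hcont : Continuous fun p : FiberProd (GermModule ρ) (GermModule ρ) =>
      germSection ρ (m + n) p.pt :=
    (continuous_germSection ρ _).comp ((isLocalHomeomorph_germ_pt ρ).continuous.comp hc1)
  refine hcont.continuousAt.congr ?_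
  filter_upwards [h1, h2]
  rintro ⟨y, s, t⟩ h1 h2
  have h3 : s = germ ρ y m := eq_of_heq (Total.mk.inj h1).2
  have h4 : t = germ ρ y n := eq_of_heq (Total.mk.inj h2).2
  subst h3 h4
  rfl

theorem continuous_germ_smul : Continuous fun p : FiberProd O.stalk (GermModule ρ) =>
    (⟨p.pt, p.fst • p.snd⟩ : Total (GermModule ρ)) := by
  rw [continuous_iff_continuousAt]
  rintro ⟨x, a, t⟩
  obtain ⟨n, rfl⟩ := germ_surjective ρ t
  obtain ⟨f, U, hU, hxU, hfU, hfx⟩ := exists_hasGerm (𝟙 x) a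
  have hi := continuous_induced_dom (t := inferInstance)
    (f := fun p : FiberProd O.stalk (GermModule ρ) =>
      ((⟨p.pt, p.fst⟩ : Total O.stalk), (⟨p.pt, p.snd⟩ : Total (GermModule ρ))))
  have hc1 := continuous_fst.comp hi
  have hc2 := continuous_snd.comp hi
  have hpt : Continuous fun p : FiberProd O.stalk (GermModule ρ) => p.pt :=
    O.isLocalHomeomorph_pt.continuous.comp hc1
  have hun : Continuous fun p : FiberProd O.stalk (GermModule ρ) => unit p.pt :=
    AmpleGroupoid.continuous_unit.comp hpt
  have h0 : ∀ᶠ p in 𝓝 (⟨x, a, germ ρ x n⟩ : FiberProd O.stalk (GermModule ρ)), unit p.pt ∈ U :=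
    hun.continuousAt.eventually (hU.isOpen.eventually_mem hxU)
  have hfc : ContinuousAt (fun p : FiberProd O.stalk (GermModule ρ) =>
      (⟨p.pt, f (unit p.pt)⟩ : Total O.stalk)) ⟨x, a, germ ρ x n⟩ :=
    ContinuousAt.comp (g := fun γ : Arr X => (⟨γ.tgt, f γ⟩ : Total O.stalk))
      (x := (⟨x, a, germ ρ x n⟩ : FiberProd O.stalk (GermModule ρ)))
      (hfU.continuousAt hU.isOpen hxU) (f := fun p : FiberProd O.stalk (GermModule ρ) => unit p.pt) hun.continuousAt
  have h1 := eventuallyEq_of_isLocalHomeomorph O.isLocalHomeomorph_pt hfc hc1.continuousAt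
    (congrArg (Total.mk x) hfx) (Filter.Eventually.of_forall fun _ => rfl)
  have h2 := (hc2.continuousAt (x := ⟨x, a, germ ρ x n⟩)).eventually
    (eventually_eq_germSection ρ n x)
  have hcont : Continuous fun p : FiberProd O.stalk (GermModule ρ) =>
      germSection ρ (ρ f n) p.pt :=
    (continuous_germSection ρ _).comp hpt
  refine hcont.continuousAt.congr ?_
  filter_upwards [h0, h1, h2]
  rintro ⟨y, b, t⟩ h0 h1 h2
  have h3 : f (unit y) = b := eq_of_heq (Total.mk.inj h1).2
  have h4 : t = germ ρ y n := eq_of_heq (Total.mk.inj h2).2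
  subst h4
  exact congrArg (Total.mk y) (smul_germ ρ ⟨U, hU, h0, hfU, h3⟩ n).symm

/-- The `𝒢`-sheaf of `𝒪`-modules `Sh(S) = (F, q, β)` attached to a `Γ_c(𝒢, 𝒪)`-module `S`: the
stalk at `x` is `S_x`, and `β_γ([m]_{d(γ)}) = [χ_U m]_{r(γ)}` for a compact open bisection `U ∋ γ`. -/
def sheafOfModule : SheafOfModules.{u, v, w, z} O where
  stalk := GermModule ρ
  isLocalHomeomorph_pt := isLocalHomeomorph_germ_pt ρ
  act γ := germAct ρ γ 1
  act_id x s := germAct_id ρ x s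
  act_comp γ β s := by rw [germAct_germAct, map_one, mul_one]
  act_smul := by
    intro x y γ a s
    show germAct ρ γ 1 (germAct ρ (𝟙 x) a s) = germAct ρ (𝟙 y) (O.act γ a) (germAct ρ γ 1 s)
    rw [germAct_germAct, germAct_germAct, map_one, mul_one, one_mul, Category.id_comp,
      Category.comp_id]
  continuous_act := continuous_germ_act ρ
  continuous_add := continuous_germ_add ρ
  continuous_smul := continuous_germ_smul ρ

theorem sheafOfModule_act_germ {U : Set (Arr X)} (hU : IsCompactOpenBisection U) {x y : X}
    {γ : x ⟶ y} (hγ : arr γ ∈ U) (m : S) :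
    (sheafOfModule ρ).act γ (germ ρ x m) = germ ρ y (ρ (chiSet O U hU) m) :=
  germAct_germ ρ (hasGerm_chiSet hU hγ) m

end Sh

section StalkModule

variable {O}

/-- The isotropy group acts on the stalk `ℳ_x` by `β`. -/
def SheafOfModules.isotropyHom (M : SheafOfModules.{u, v, w, z} O) (x : X) :
    End x →* AddMonoid.End (M.stalk x) where
  toFun δ := M.act (End.asHom δ)
  map_one' := AddMonoidHom.ext fun m => M.act_id x m
  map_mul' β γ := AddMonoidHom.ext fun m => (M.act_comp (End.asHom γ) (End.asHom β) m).symm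

/-- The action of `B_x` on the stalk `ℳ_x`, `bδ · m = b β_δ(m)`. -/
def SheafOfModules.stalkHom (M : SheafOfModules.{u, v, w, z} O) (x : X) :
    IsotropyRing O x →+* AddMonoid.End (M.stalk x) :=
  SkewMonoidAlgebra.liftNCRingHom (Module.toAddMonoidEnd (O.stalk x) (M.stalk x))
    (M.isotropyHom x) (by
      intro b δ
      exact AddMonoidHom.ext fun m => (M.act_smul (End.asHom δ) b m).symm)

/-- The left `B_x`-module structure on the stalk `ℳ_x`. -/
instance SheafOfModules.stalkModule (M : SheafOfModules.{u, v, w, z} O) (x : X) :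
    Module (IsotropyRing O x) (M.stalk x) :=
  Module.compHom (M.stalk x) (M.stalkHom x)

theorem SheafOfModules.single_smul (M : SheafOfModules.{u, v, w, z} O) {x : X} (δ : End x)
    (b : O.stalk x) (m : M.stalk x) :
    (SkewMonoidAlgebra.single δ b : IsotropyRing O x) • m = b • M.act (End.asHom δ) m := by
  have h : M.stalkHom x (SkewMonoidAlgebra.single δ b) =
      Module.toAddMonoidEnd (O.stalk x) (M.stalk x) b * M.isotropyHom x δ :=
    SkewMonoidAlgebra.liftNC_single _ _ _ _
  show M.stalkHom x (SkewMonoidAlgebra.single δ b) m = _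
  rw [h]
  rfl

end StalkModule

end AmpleSheaf

end

open CategoryTheory AmpleSheaf

noncomputable section

namespace AmpleSheaf

/-! Everything rests on a comparison of S with the direct sum of its stalks along one orbit. The map
a1_γ ⊗ s ↦ a β_γ(s) identifies Ind_x(S_x) with ⨁ S_y, where y runs over the orbit of x
(`stalksToInd_indToStalks`, `indToStalks_stalksToInd_of`). On germs of S and on this direct sum an
element f acts by one and the same formula: the component at z is ∑ f(β) β_β(s_y), over the arrows β
: y → z (`germ_rep`, `indToStalks_ind`). For given f and z only finitely many arrows contribute.

If f kills S, it kills Ind_x(S_x). An element of the sum concentrated at y is the germ of some m ∈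
S; cutting m down by χ_V, for a small V around y, removes its germs at the finitely many other
points that matter for z. The component at z is then the germ of f χ_V m = 0. This inclusion holds
for every module.

Conversely, if f kills Ind_x(S_x), the germ of fm at a point z of the orbit depends on finitely many
germs of m along the orbit. These form an element of the direct sum, so the germ vanishes. Thus fm
lies in the submodule of elements whose germs are zero along the orbit of x. When S_x ≠ 0 this
submodule is proper, and simplicity makes it zero, so fm = 0.

A non-zero stalk exists because, by compactness, an element with no non-zero germ is killed by every
χ_V, whereas RS = S makes some χ_V fix it. -/

theorem finsum_sigma_eq_single {ι : Type*} {κ : ι → Type*} {A : Type*} [AddCommMonoid A]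
    (i : ι) (F : (Σ j, κ j) → A) (h : ∀ j (k : κ j), j ≠ i → F ⟨j, k⟩ = 0) :
    ∑ᶠ b, F b = ∑ᶠ k : κ i, F ⟨i, k⟩ := by
  rw [← finsum_mem_range (f := F) (g := fun k : κ i => (⟨i, k⟩ : Σ j, κ j)) sigma_mk_injective]
  rw [← finsum_mem_univ]
  refine (finsum_mem_inter_support_eq F _ _ ?_)
  ext ⟨j, k⟩
  simp only [Set.univ_inter, Function.mem_support, Set.mem_inter_iff, Set.mem_range, iff_and_self]
  intro hF
  obtain rfl : j = i := by_contra fun hj => hF (h j k hj)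
  exact ⟨k, rfl⟩

variable {X : Type u} [TopologicalSpace X] [Groupoid.{v} X] [AmpleGroupoid X]
  {O : SheafOfRings.{u, v, w} X} {S : Type z} [AddCommGroup S] (ρ : Gamma O →ₙ+* AddMonoid.End S)

/-! ### Local units and the existence of a non-zero stalk -/

theorem gamma_induction {p : Gamma O → Prop} (h0 : p 0) (hadd : ∀ f g, p f → p g → p (f + g))
    (hneg : ∀ f, p f → p (-f))
    (hmem : ∀ (f : Gamma O) (U : Set (Arr X)), IsCompactOpenBisection U → SupportedOn f.1 U → p f)
    (f : Gamma O) : p f := by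
  refine AddSubgroup.closure_induction (p := fun f hf => p ⟨f, hf⟩) ?_ h0
    (fun f g hf hg => hadd ⟨f, hf⟩ ⟨g, hg⟩) (fun f hf => hneg ⟨f, hf⟩) f.2
  rintro f ⟨U, hU, hfU⟩
  exact hmem _ U hU hfU

theorem chi_eq_zero {V : CompactOpens X} (h : ∀ x, x ∉ V) : chi O V = 0 := by
  refine gamma_ext fun γ => if_neg ?_
  rintro ⟨y, hy, -⟩
  exact h y hy

/-- Inclusion–exclusion. It lets the vanishing of χ_V m and χ_W m pass to the union of V and W. -/
theorem chi_sup_mul (V W : CompactOpens X) (f : Gamma O) :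
    chi O (V ⊔ W) * f = chi O V * f + chi O W * f - chi O V * (chi O W * f) := by
  refine gamma_ext fun γ => ?_
  have h : (chi O V * f + chi O W * f - chi O V * (chi O W * f)).1 γ =
    (chi O V * f).1 γ + (chi O W * f).1 γ - (chi O V * (chi O W * f)).1 γ := rfl
  rw [h]
  simp only [chi_mul_apply]
  have hVW : γ.tgt ∈ V ⊔ W ↔ γ.tgt ∈ V ∨ γ.tgt ∈ W := by
    rw [← SetLike.mem_coe, CompactOpens.coe_sup]
    rfl
  by_cases h1 : γ.tgt ∈ V <;> by_cases h2 : γ.tgt ∈ W <;> simp [h1, h2, hVW]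

theorem chi_mul_self (V : CompactOpens X) : chi O V * chi O V = chi O V := by
  rw [chi_mul_chi, inf_idem]

/-- Every element of `Γ_c(𝒢, 𝒪)` vanishes off `r⁻¹(V)` for some compact open `V`. -/
theorem exists_chi_mul_eq_self (f : Gamma O) :
    ∃ V : CompactOpens X, ∀ W, V ≤ W → chi O W * f = f := by
  -- Multiplying by χ_W on the left restricts f to r⁻¹(W), so any W containing the ranges of the
  -- support works.
  suffices h : ∃ V : CompactOpens X, ∀ γ, f γ ≠ 0 → γ.tgt ∈ V by
    obtain ⟨V, hV⟩ := h
    refine ⟨V, fun W hW => gamma_ext fun γ => ?_⟩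
    rw [chi_mul_apply]
    split_ifs with hγ
    · rfl
    · exact (by_contra fun h => hγ (hW (hV γ (Ne.symm h))))
  induction f using gamma_induction with
  | hmem f U hU hfU =>
    exact ⟨⟨⟨Arr.tgt '' U, hU.isCompact.image AmpleGroupoid.continuous_tgt⟩,
      isOpenMap_tgt _ hU.isOpen⟩, fun γ hγ => ⟨γ, by_contra fun h => hγ (hfU.2 γ h), rfl⟩⟩
  | h0 => exact ⟨⊥, fun γ h => absurd rfl h⟩
  | hadd f g hf hg =>
    obtain ⟨V, hV⟩ := hf
    obtain ⟨W, hW⟩ := hg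
    refine ⟨V ⊔ W, fun γ h => ?_⟩
    by_cases h1 : f γ = 0
    · exact (le_sup_right : W ≤ V ⊔ W) (hW γ fun h2 => h ((congrArg₂ (· + ·) h1 h2).trans (add_zero 0)))
    · exact (le_sup_left : V ≤ V ⊔ W) (hV γ h1)
  | hneg f hf =>
    obtain ⟨V, hV⟩ := hf
    exact ⟨V, fun γ h => hV γ fun h1 => h ((congrArg Neg.neg h1).trans neg_zero)⟩

/-- The idempotents χ_V are local units of R, and RS = S carries this over to S. Stability under
enlarging V is what allows the sets belonging to two summands to be joined. -/
theorem exists_rep_chi_eq_self {ρ : Gamma O →ₙ+* AddMonoid.End S}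
    (h : AddSubgroup.closure {s : S | ∃ (f : Gamma O) (m : S), s = ρ f m} = ⊤) (m : S) :
    ∃ V : CompactOpens X, ∀ W, V ≤ W → ρ (chi O W) m = m := by
  have hm : m ∈ AddSubgroup.closure {s : S | ∃ (f : Gamma O) (m : S), s = ρ f m} := h ▸ trivial
  induction hm using AddSubgroup.closure_induction with
  | mem m hm =>
    obtain ⟨f, n, rfl⟩ := hm
    obtain ⟨V, hV⟩ := exists_chi_mul_eq_self f
    exact ⟨V, fun W hW => by rw [← rep_mul, hV W hW]⟩
  | zero => exact ⟨⊥, fun W _ => map_zero _⟩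
  | add m n _ _ hm hn =>
    obtain ⟨V, hV⟩ := hm
    obtain ⟨W, hW⟩ := hn
    exact ⟨V ⊔ W, fun K hK => by
      rw [map_add, hV K (le_sup_left.trans hK), hW K (le_sup_right.trans hK)]⟩
  | neg m _ hm =>
    obtain ⟨V, hV⟩ := hm
    exact ⟨V, fun W hW => by rw [map_neg, hV W hW]⟩

/-- An element all of whose germs vanish is annihilated by every `χ_V`. -/
theorem rep_chi_eq_zero_of_germ {m : S} (hm : ∀ x, germ ρ x m = 0) (V : CompactOpens X) :
    ρ (chi O V) m = 0 := by
  obtain ⟨W, hVW, hW⟩ : ∃ W : CompactOpens X, (V : Set X) ⊆ W ∧ ρ (chi O W) m = 0 := by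
    -- Lying inside some W with χ_W m = 0 is inherited by subsets and finite unions, and holds near
    -- each point because the germ of m there is zero.
    refine V.isCompact.induction_on (p := fun s : Set X => ∃ W : CompactOpens X, s ⊆ W ∧
      ρ (chi O W) m = 0) ?_ ?_ ?_ ?_
    · refine ⟨⊥, Set.empty_subset _, ?_⟩
      rw [chi_eq_zero (V := ⊥) (fun x hx => Set.notMem_empty x hx), map_zero]
      rfl
    · rintro s t hst ⟨W, h1, h2⟩
      exact ⟨W, hst.trans h1, h2⟩
    · rintro s t ⟨W, h1, h2⟩ ⟨K, h3, h4⟩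
      refine ⟨W ⊔ K, ?_, ?_⟩
      · rw [CompactOpens.coe_sup]
        exact Set.union_subset_union h1 h3
      -- Inclusion–exclusion is applied to χ_{W ∪ K} itself; absorption turns it into χ_{W ∪ K} =
      -- χ_W + χ_K − χ_W χ_K.
      · have h5 := chi_sup_mul W K (chi O (W ⊔ K))
        rw [chi_mul_self, chi_mul_chi K, inf_eq_left.2 (le_sup_right : K ≤ W ⊔ K), chi_mul_chi W,
          inf_eq_left.2 (le_sup_left : W ≤ W ⊔ K)] at h5
        rw [h5, map_sub, map_add, map_mul]
        show ρ (chi O W) m + ρ (chi O K) m - ρ (chi O W) (ρ (chi O K) m) = 0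
        rw [h2, h4, map_zero, add_zero, sub_zero]
    · intro x _
      obtain ⟨W, hx, hW⟩ := (germ_eq_zero ρ).1 (hm x)
      exact ⟨W, mem_nhdsWithin_of_mem_nhds (W.isOpen.mem_nhds hx), W, subset_rfl, hW⟩
  have h1 : V ⊓ W = V := inf_eq_left.2 hVW
  rw [← h1, ← chi_mul_chi, rep_mul, hW, map_zero]

/-- If all stalks were zero, a non-zero m would be killed by every χ_V, including one that fixes it.
Of simplicity only S ≠ 0 and RS = S enter. -/
theorem IsSimpleRep.exists_nontrivial_germModule {ρ : Gamma O →ₙ+* AddMonoid.End S}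
    (hρ : IsSimpleRep ρ) : ∃ x : X, Nontrivial (GermModule ρ x) := by
  by_contra! h
  have := hρ.nontrivial
  obtain ⟨m, hm⟩ := exists_ne (0 : S)
  obtain ⟨V, hV⟩ := exists_rep_chi_eq_self hρ.unitary m
  refine hm ((hV V le_rfl).symm.trans (rep_chi_eq_zero_of_germ ρ (fun x => ?_) V))
  have := h x
  exact Subsingleton.elim _ _

/-! ### The action of the convolution ring on germs -/

theorem germ_rep_eq_zero_of_disjoint {V : CompactOpens X} {f : Gamma O} {x : X}
    (hV : x ∉ V) (hf : ∀ γ, f γ ≠ 0 → γ.tgt ∈ V) (m : S) : germ ρ x (ρ f m) = 0 := by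
  -- A compact V is closed in the Hausdorff unit space, so x has a compact open neighbourhood W
  -- missing V, and then χ_W f = 0.
  obtain ⟨W, hx, hW⟩ := exists_compactOpens V.isCompact.isClosed.isOpen_compl hV
  refine (germ_eq_zero ρ).2 ⟨W, hx, ?_⟩
  have : chi O W * f = 0 := gamma_ext fun γ => by
    rw [chi_mul_apply]
    split_ifs with h
    · exact by_contra fun h' => hW h (hf γ h')
    · rfl
  rw [← rep_mul, this, map_zero]
  rfl

theorem germ_rep_chi_of_notMem {V : CompactOpens X} {x : X} (hV : x ∉ V) (m : S) :
    germ ρ x (ρ (chi O V) m) = 0 := by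
  refine germ_rep_eq_zero_of_disjoint ρ hV (fun γ hγ => ?_) m
  by_contra h
  refine hγ (if_neg ?_)
  rintro ⟨y, hy, rfl⟩
  exact h hy

theorem finite_germAct (f : Gamma O) {z : X} (s : ∀ y, GermModule ρ y) :
    Function.HasFiniteSupport fun b : (Σ y : X, (y ⟶ z)) =>
      germAct ρ b.2 (f (arr b.2)) (s b.1) := by
  refine Set.Finite.subset (s := {b | f (arr b.2) ≠ 0}) ?_ ?_
  · exact finite_into f.2 z
  intro b hb h
  refine hb ?_
  simp only [h, germAct_zero]

/-- The action of `f` on germs, `[f m]_z = ∑_{r(β) = z} f(β) β_β([m]_{d(β)})`. -/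
theorem germ_rep (f : Gamma O) (z : X) (m : S) :
    germ ρ z (ρ f m) =
      ∑ᶠ b : (Σ y : X, (y ⟶ z)), germAct ρ b.2 (f (arr b.2)) (germ ρ b.1 m) := by
  induction f using gamma_induction with
  | hmem f U hU hfU =>
    -- Since r is injective on U, at most one arrow of U ends at z. If there is one, the sum has a
    -- single term, computed by f itself; if there is none, z lies off the compact set r(U) and both
    -- sides vanish.
    by_cases hz : ∃ b : (Σ y : X, (y ⟶ z)), arr b.2 ∈ U
    · obtain ⟨⟨y, β⟩, hβ⟩ := hz
      rw [finsum_eq_single _ (⟨y, β⟩ : Σ y : X, (y ⟶ z))]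
      · exact (germAct_germ ρ ⟨U, hU, hβ, hfU, rfl⟩ m).symm
      · rintro ⟨y', β'⟩ hne
        have h0 : f (arr β') = 0 := by
          refine hfU.2 _ fun h => hne ?_
          have := hU.injOn_tgt h hβ rfl
          cases this
          rfl
        show germAct ρ β' (f (arr β')) _ = 0
        rw [h0, germAct_zero]
    · push Not at hz
      rw [finsum_eq_zero_of_forall_eq_zero]
      · refine germ_rep_eq_zero_of_disjoint ρ (V := ⟨⟨Arr.tgt '' U,
          hU.isCompact.image AmpleGroupoid.continuous_tgt⟩, isOpenMap_tgt _ hU.isOpen⟩) ?_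
          (fun γ hγ => ⟨γ, by_contra fun h => hγ (hfU.2 γ h), rfl⟩) m
        rintro ⟨γ, hγ, rfl⟩
        exact hz ⟨_, γ.hom⟩ hγ
      · rintro b
        show germAct ρ b.2 (f (arr b.2)) _ = 0
        rw [hfU.2 _ (hz b), germAct_zero]
  | h0 =>
    rw [map_zero, finsum_eq_zero_of_forall_eq_zero fun b => germAct_zero ρ b.2 _]
    rfl
  | hadd f g h1 h2 =>
    rw [rep_add, germ_add, h1, h2]
    refine (finsum_add_distrib (finite_germAct ρ f fun y => germ ρ y m)
      (finite_germAct ρ g fun y => germ ρ y m)).symm.trans (finsum_congr fun b => ?_)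
    exact (germAct_add ρ b.2 _ _ _).symm
  | hneg f h1 =>
    rw [map_neg]
    show - germ ρ z (ρ f m) = _
    rw [h1, ← finsum_neg_distrib]
    -- The value at the coefficient −f(β) follows from additivity in the coefficient and −f(β) +
    -- f(β) = 0.
    refine finsum_congr fun b => neg_eq_of_add_eq_zero_left ?_
    refine (germAct_add ρ b.2 _ _ _).symm.trans ?_
    show germAct ρ b.2 (-f (arr b.2) + f (arr b.2)) _ = 0
    rw [neg_add_cancel, germAct_zero]

/-! ### The induced module as the direct sum of the stalks along an orbit -/

/-- The left `B_x`-module structure on the stalk `S_x` of `Sh(S)`. -/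
instance germIsotropyModule (x : X) : Module (IsotropyRing O x) (GermModule ρ x) :=
  inferInstanceAs (Module (IsotropyRing O x) ((sheafOfModule ρ).stalk x))

/-- Scalar multiplication by b and the action of δ are both instances of `germAct`, and such maps
compose to a single one. -/
theorem single_smul_germ {x : X} (δ : End x) (b : O.stalk x) (s : GermModule ρ x) :
    (SkewMonoidAlgebra.single δ b : IsotropyRing O x) • s = germAct ρ (End.asHom δ) b s := by
  refine ((sheafOfModule ρ).single_smul δ b s).trans ?_
  show germAct ρ (𝟙 x) b (germAct ρ (End.asHom δ) 1 s) = _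
  rw [germAct_germAct, map_one, mul_one, Category.comp_id]

/-- The biadditive map `(a1_γ, s) ↦ a β_γ(s) ∈ S_{r(γ)}`. -/
def orbitPairing (x : X) : LMod O x →+ GermModule ρ x →+ ⨁ y, GermModule ρ y :=
  DirectSum.toAddMonoid fun γ : (Σ y : X, (x ⟶ y)) =>
    { toFun := fun a => (DirectSum.of (GermModule ρ) γ.1).comp (germAct ρ γ.2 a)
      map_zero' := AddMonoidHom.ext fun s => by
        show DirectSum.of _ _ (germAct ρ γ.2 0 s) = 0
        rw [germAct_zero, map_zero]
      map_add' := fun a b => AddMonoidHom.ext fun s => by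
        show DirectSum.of _ _ (germAct ρ γ.2 (a + b) s) =
          DirectSum.of _ _ (germAct ρ γ.2 a s) + DirectSum.of _ _ (germAct ρ γ.2 b s)
        rw [germAct_add, map_add] }

theorem orbitPairing_lsingle {x y : X} (γ : x ⟶ y) (a : O.stalk y)
    (s : GermModule ρ x) :
    orbitPairing ρ x (lsingle O γ a) s = DirectSum.of (GermModule ρ) y (germAct ρ γ a s) := by
  have h : orbitPairing ρ x (lsingle O γ a) =
      (DirectSum.of (GermModule ρ) y).comp (germAct ρ γ a) := DirectSum.toAddMonoid_of _ _ _
  rw [h]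
  rfl

/-- This balancedness makes the pairing descend to the tensor product over B_x: for ξ = a1_γ and the
ring element bδ, both sides are a α_γ(b) β_{γδ}(s), placed at r(γ). -/
theorem orbitPairing_op_smul (x : X) (ξ : LMod O x) (b : IsotropyRing O x)
    (s : GermModule ρ x) :
    orbitPairing ρ x (MulOpposite.op b • ξ) s = orbitPairing ρ x ξ (b • s) := by
  induction b using SkewMonoidAlgebra.induction_on with
  | zero => simp
  | single δ b =>
    induction ξ using DirectSum.induction_on with
    | zero => simp
    | of i a =>
      obtain ⟨y, γ⟩ := i
      change orbitPairing ρ x (_ • lsingle O γ a) s = orbitPairing ρ x (lsingle O γ a) _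
      rw [op_single_smul_lsingle, orbitPairing_lsingle, orbitPairing_lsingle, single_smul_germ,
        germAct_germAct]
    | add ξ ζ h1 h2 =>
      rw [smul_add, map_add, map_add, AddMonoidHom.add_apply, AddMonoidHom.add_apply, h1, h2]
  | add b c h1 h2 =>
    rw [MulOpposite.op_add, add_smul, add_smul, map_add, map_add, AddMonoidHom.add_apply, h1, h2]

/-- The map `Ind_x(S_x) → ⨁_y S_y`, `a1_γ ⊗ s ↦ a β_γ(s)`; its image is the sum over the orbit. -/
def indToStalks (x : X) :
    IndModule O x (GermModule ρ x) →+ ⨁ y, GermModule ρ y :=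
  QuotientAddGroup.lift _ (TensorProduct.liftAddHom (R := ℤ) (orbitPairing ρ x)
    (fun n ξ s => by rw [map_zsmul, map_zsmul]; rfl)) (by
      refine (AddSubgroup.closure_le _).2 ?_
      rintro _ ⟨ξ, b, s, rfl⟩
      show TensorProduct.liftAddHom _ _ _ = 0
      rw [map_sub, TensorProduct.liftAddHom_tmul, TensorProduct.liftAddHom_tmul,
        orbitPairing_op_smul, sub_self])

/-- The element `ξ ⊗ s` of `Ind_x(M)`. -/
def indTmul {x : X} {M : Type z} [AddCommGroup M] [Module (IsotropyRing O x) M] (ξ : LMod O x)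
    (s : M) : IndModule O x M :=
  QuotientAddGroup.mk (ξ ⊗ₜ[ℤ] s)

theorem indToStalks_indTmul {x : X} (ξ : LMod O x) (s : GermModule ρ x) :
    indToStalks ρ x (indTmul ξ s) = orbitPairing ρ x ξ s := rfl

theorem indToStalks_lsingle {x y : X} (γ : x ⟶ y) (a : O.stalk y)
    (s : GermModule ρ x) :
    indToStalks ρ x (indTmul (lsingle O γ a) s) =
      DirectSum.of (GermModule ρ) y (germAct ρ γ a s) :=
  orbitPairing_lsingle ρ γ a s

theorem indTmul_add_left {x : X} {M : Type z} [AddCommGroup M] [Module (IsotropyRing O x) M]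
    (ξ ζ : LMod O x) (s : M) : indTmul (ξ + ζ) s = indTmul ξ s + indTmul ζ s := by
  unfold indTmul
  rw [TensorProduct.add_tmul]
  rfl

theorem indTmul_op_smul {x : X} {M : Type z} [AddCommGroup M] [Module (IsotropyRing O x) M]
    (ξ : LMod O x) (b : IsotropyRing O x) (s : M) :
    indTmul (MulOpposite.op b • ξ) s = indTmul ξ (b • s) := by
  refine sub_eq_zero.1 ?_
  exact (QuotientAddGroup.eq_zero_iff _).2 (AddSubgroup.subset_closure ⟨ξ, b, s, rfl⟩)

/-- No clause for negatives is needed, because the elements a1_γ ⊗ s are closed under negation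
through a. -/
theorem indModule_induction {x : X} {M : Type z} [AddCommGroup M] [Module (IsotropyRing O x) M]
    {p : IndModule O x M → Prop} (h0 : p 0) (hadd : ∀ t t', p t → p t' → p (t + t'))
    (h : ∀ (y : X) (γ : x ⟶ y) (a : O.stalk y) (s : M), p (indTmul (lsingle O γ a) s))
    (t : IndModule O x M) : p t := by
  obtain ⟨t, rfl⟩ := QuotientAddGroup.mk_surjective t
  induction t using TensorProduct.induction_on with
  | zero => exact h0
  | add s t hs ht => exact hadd _ _ hs ht
  | tmul ξ s =>
    change p (indTmul ξ s)
    induction ξ using DirectSum.induction_on with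
    | zero =>
      have : indTmul (0 : LMod O x) s = 0 := by
        unfold indTmul
        rw [TensorProduct.zero_tmul]
        rfl
      rw [this]
      exact h0
    | of i a => exact h i.1 i.2 a s
    | add ξ ζ h1 h2 =>
      rw [indTmul_add_left]
      exact hadd _ _ h1 h2

/-- The left inverse `s ↦ 1_γ ⊗ β_γ⁻¹(s)` of `indToStalks` given by a choice of an arrow
`γ : x → y` for every point `y` of the orbit of `x`. -/
def stalksToInd (x : X) : (⨁ y, GermModule ρ y) →+ IndModule O x (GermModule ρ x) :=
  DirectSum.toAddMonoid fun y =>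
    if h : Nonempty (x ⟶ y) then
      (QuotientAddGroup.mk' _).comp
        ((TensorProduct.mk ℤ (LMod O x) (GermModule ρ x)
          (lsingle O h.some 1)).toAddMonoidHom.comp (germAct ρ (Groupoid.inv h.some) 1))
    -- The value off the orbit is immaterial: the image of `indToStalks` is concentrated on the
    -- orbit of x.
    else 0

/-- Hides the choice of arrow: later arguments use only that the map is given by some γ : x → y, the
same for all s. -/
theorem exists_stalksToInd_of {x y : X} (h : Nonempty (x ⟶ y)) : ∃ γ : x ⟶ y,
    ∀ s, stalksToInd ρ x (DirectSum.of (GermModule ρ) y s) =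
      indTmul (lsingle O γ 1) (germAct ρ (Groupoid.inv γ) 1 s) := by
  refine ⟨h.some, fun s => ?_⟩
  unfold stalksToInd
  rw [DirectSum.toAddMonoid_of, dif_pos h]
  rfl

/-- Two arrows from x to the same point differ by an element of the isotropy group, which is
absorbed by the tensor product over B_x. In particular `indToStalks` is injective, so vanishing in
Ind_x(S_x) can be tested on stalks. -/
theorem stalksToInd_indToStalks {x : X} (t : IndModule O x (GermModule ρ x)) :
    stalksToInd ρ x (indToStalks ρ x t) = t := by
  induction t using indModule_induction with
  | h0 => rw [map_zero, map_zero]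
  | hadd t t' h h' => rw [map_add, map_add, h, h']
  | h y γ a s =>
    obtain ⟨δ, hδ⟩ := exists_stalksToInd_of ρ ⟨γ⟩
    rw [indToStalks_lsingle, hδ, germAct_germAct, one_mul]
    -- Here δ is the chosen arrow, and δ⁻¹γ is a loop at x. Thus β_δ⁻¹(a β_γ(s)) is the element
    -- α_{δ⁻¹}(a) δ⁻¹γ of B_x applied to s; moved to the left of the tensor sign, it turns 1_δ into
    -- a1_γ.
    have h := single_smul_germ ρ (End.of (γ ≫ Groupoid.inv δ)) (O.act (Groupoid.inv δ) a) s
    refine (congrArg (indTmul (lsingle O δ 1)) h.symm).trans ?_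
    rw [← indTmul_op_smul, op_single_smul_lsingle, one_mul, O.act_comp]
    have h1 : lsingle O (End.asHom (End.of (γ ≫ Groupoid.inv δ)) ≫ δ)
        (O.act (Groupoid.inv δ ≫ δ) a) = lsingle O γ a := by
      have e : Groupoid.inv δ ≫ δ = 𝟙 y := Groupoid.inv_comp δ
      rw [e, O.act_id]
      refine lsingle_congr ?_ a
      show (γ ≫ Groupoid.inv δ) ≫ δ = γ
      simp
    rw [h1]

/-- Every stalk over the orbit is hit, so germs along the orbit can be lifted to the induced module.
-/
theorem indToStalks_stalksToInd_of {x y : X} (h : Nonempty (x ⟶ y)) (s : GermModule ρ y) :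
    indToStalks ρ x (stalksToInd ρ x (DirectSum.of (GermModule ρ) y s)) =
      DirectSum.of (GermModule ρ) y s := by
  obtain ⟨δ, hδ⟩ := exists_stalksToInd_of ρ h
  rw [hδ, indToStalks_lsingle, germAct_germAct, one_mul, map_one, Groupoid.inv_comp, germAct_id]

/-! ### The action of the convolution ring on the induced module -/

/-- The action of `f` on `Ind_x(S_x)` in terms of stalks. -/
theorem indToStalks_ind (x : X) (f : Gamma O) (t : IndModule O x (GermModule ρ x))
    (z : X) :
    indToStalks ρ x (ind O x _ f t) z =
      ∑ᶠ b : (Σ y : X, (y ⟶ z)), germAct ρ b.2 (f (arr b.2)) (indToStalks ρ x t b.1) := by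
  induction t using indModule_induction with
  | h0 => simp
  | hadd t t' h h' =>
    rw [map_add, map_add, DirectSum.add_apply, h, h', map_add,
      ← finsum_add_distrib (finite_germAct ρ f fun y => indToStalks ρ x t y)
        (finite_germAct ρ f fun y => indToStalks ρ x t' y)]
    simp only [DirectSum.add_apply, map_add]
  | h y γ a s =>
    have h1 : indToStalks ρ x (ind O x _ f (indTmul (lsingle O γ a) s)) =
        ∑ᶠ β : (Σ z : X, (y ⟶ z)),
          DirectSum.of (GermModule ρ) β.1 (germAct ρ β.2 (f (arr β.2)) (germAct ρ γ a s)) := by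
      have h2 : ind O x (GermModule ρ x) f (indTmul (lsingle O γ a) s) =
        indTmul (lmul x f (lsingle O γ a)) s := rfl
      have hfin : (Function.support fun β : (Σ z : X, (y ⟶ z)) =>
          lsingle O (γ ≫ β.2) (f (arr β.2) * O.act β.2 a)).Finite := by
        refine (finite_out f.2 y).subset fun β hβ h => hβ ?_
        simp only [h, zero_mul, map_zero]
      -- With s fixed the pairing is additive in its first argument, so it passes through the finite
      -- sum over arrows out of y.
      rw [h2, indToStalks_indTmul, lmul_lsingle_eq_finsum,
        ← AddMonoidHom.flip_apply, AddMonoidHom.map_finsum _ hfin]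
      refine finsum_congr fun β => ?_
      rw [AddMonoidHom.flip_apply, orbitPairing_lsingle, germAct_germAct]
    have hfin : (Function.support fun β : (Σ z : X, (y ⟶ z)) =>
        DirectSum.of (GermModule ρ) β.1
          (germAct ρ β.2 (f (arr β.2)) (germAct ρ γ a s))).Finite := by
      refine (finite_out f.2 y).subset fun β hβ h => hβ ?_
      simp only [h, germAct_zero, map_zero]
    have h3 := AddMonoidHom.map_finsum (DFinsupp.evalAddMonoidHom z) hfin
    rw [h1, indToStalks_lsingle]
    refine (h3 : _ = _).trans ?_
    -- The left sum runs over arrows out of y and keeps those ending at z; the right sum runs over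
    -- arrows into z and keeps those starting at y. Both reduce to the arrows y → z.
    rw [finsum_sigma_eq_single z, finsum_sigma_eq_single y]
    · refine finsum_congr fun β => ?_
      rw [DirectSum.of_eq_same]
      show DirectSum.of (GermModule ρ) z _ z = _
      exact DirectSum.of_eq_same _ _
    · intro y' β hy
      show germAct ρ β _ (DirectSum.of (GermModule ρ) y _ y') = 0
      rw [DirectSum.of_eq_of_ne _ _ _ hy, map_zero]
    · intro z' β hz
      exact DirectSum.of_eq_of_ne _ _ _ hz.symm

/-! ### Elements annihilating S annihilate the induced module -/

theorem exists_compactOpens_inter_finite {F : Set X} (hF : F.Finite) (x : X) :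
    ∃ V : CompactOpens X, x ∈ V ∧ ∀ y ∈ F, y ∈ V → y = x := by
  have hF' : (F \ {x}).Finite := hF.subset Set.sdiff_subset
  obtain ⟨V, hx, hV⟩ := exists_compactOpens hF'.isClosed.isOpen_compl (x := x) (by simp)
  exact ⟨V, hx, fun y hy hyV => by_contra fun h => hV hyV ⟨hy, h⟩⟩

/-- The annihilator of `S` annihilates every `Ind_x(S_x)`. -/
theorem annihilator_le_annihilator_ind (x : X) :
    annihilator ρ ≤ annihilator (ind O x (GermModule ρ x)) := by
  intro f hf
  have hf : ρ f = 0 := (TwoSidedIdeal.mem_ker _).1 hf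
  refine (TwoSidedIdeal.mem_ker _).2 (AddMonoidHom.ext fun t => ?_)
  show ind O x _ f t = 0
  induction t using indModule_induction with
  | h0 => rw [map_zero]
  | hadd t t' h h' => rw [map_add, h, h', add_zero]
  | h y γ a s =>
    -- By the left inverse it suffices that all components in the stalks vanish; they are treated
    -- one z at a time, since the set V below depends on z.
    rw [← stalksToInd_indToStalks ρ (ind O x _ f _)]
    refine (congrArg (stalksToInd ρ x) (DFinsupp.ext fun z => ?_)).trans (map_zero _)
    refine (indToStalks_ind ρ x f _ z).trans ?_
    rw [indToStalks_lsingle]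
    obtain ⟨m, hm⟩ := germ_surjective ρ (germAct ρ γ a s)
    -- V contains y but no other source of an arrow into z at which f is non-zero. At all sources
    -- that count, χ_V m therefore has the germs of the element concentrated at y, and the component
    -- at z is the germ of f χ_V m = 0.
    obtain ⟨V, hy, hV⟩ := exists_compactOpens_inter_finite
      ((finite_into f.2 z).image Sigma.fst) y
    have h := germ_rep ρ f z (ρ (chi O V) m)
    rw [hf] at h
    refine Eq.trans (finsum_congr fun b => ?_) h.symm
    by_cases hb : f (arr b.2) = 0
    · rw [hb, germAct_zero, germAct_zero]
    · refine congrArg _ ?_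
      by_cases hby : b.1 = y
      · obtain ⟨y', β⟩ := b
        obtain rfl : y' = y := hby
        rw [germ_chi ρ hy, hm]
        exact DirectSum.of_eq_same _ _
      · rw [germ_rep_chi_of_notMem ρ fun h' => hby (hV _ ⟨b, hb, rfl⟩ h')]
        exact DirectSum.of_eq_of_ne _ _ _ hby

/-! ### The converse inclusion, by simplicity -/

/-- The elements of `S` whose germs vanish along the orbit of `x`. -/
def orbitNull (x : X) : AddSubgroup S where
  carrier := {m | ∀ y, Nonempty (x ⟶ y) → germ ρ y m = 0}
  zero_mem' y _ := rfl
  add_mem' hm hn y h := by rw [germ_add, hm y h, hn y h, add_zero]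
  neg_mem' {m} hm y h := by
    show - germ ρ y m = 0
    rw [hm y h, neg_zero]

/-- An arrow ending in the orbit also starts in it, so the germs of fm along the orbit are
determined by those of m. Hence `orbitNull` is a submodule, to which simplicity can be applied. -/
theorem rep_mem_orbitNull {x : X} (f : Gamma O) {m : S} (hm : m ∈ orbitNull ρ x) :
    ρ f m ∈ orbitNull ρ x := by
  rintro z ⟨γ⟩
  rw [germ_rep]
  refine finsum_eq_zero_of_forall_eq_zero fun b => ?_
  rw [hm b.1 ⟨γ ≫ Groupoid.inv b.2⟩, map_zero]

/-- At a point z of the orbit, f and m interact through finitely many germs of m only; these come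
from an element of Ind_x(S_x), which f kills. -/
theorem rep_mem_orbitNull_of_mem_annihilator {x : X} {f : Gamma O}
    (hf : f ∈ annihilator (ind O x (GermModule ρ x))) (m : S) :
    ρ f m ∈ orbitNull ρ x := by
  have hf : ind O x (GermModule ρ x) f = 0 := (TwoSidedIdeal.mem_ker _).1 hf
  rintro z ⟨γ⟩
  -- The germs of m along the orbit need not be finitely supported. F holds the points whose germs
  -- enter the value of fm at z, and truncating to F gives an element of the direct sum, lifted to t
  -- below.
  set F := ((finite_into f.2 z).image Sigma.fst).toFinset with hF
  have hFx : ∀ y ∈ F, Nonempty (x ⟶ y) := by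
    intro y hy
    rw [hF, Set.Finite.mem_toFinset] at hy
    obtain ⟨b, -, rfl⟩ := hy
    exact ⟨γ ≫ Groupoid.inv b.2⟩
  let t := ∑ y ∈ F, stalksToInd ρ x (DirectSum.of (GermModule ρ) y (germ ρ y m))
  have ht : indToStalks ρ x t = ∑ y ∈ F, DirectSum.of (GermModule ρ) y (germ ρ y m) := by
    rw [map_sum]
    exact Finset.sum_congr rfl fun y hy => indToStalks_stalksToInd_of ρ (hFx y hy) _
  have h := indToStalks_ind ρ x f t z
  rw [hf] at h
  have h0 : indToStalks ρ x ((0 : AddMonoid.End (IndModule O x _)) t) z = 0 := by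
    rw [AddMonoid.End.zero_apply, map_zero]
    rfl
  rw [germ_rep]
  refine Eq.trans (finsum_congr fun b => ?_) (h.symm.trans h0)
  by_cases hb : f (arr b.2) = 0
  · rw [hb, germAct_zero, germAct_zero]
  · refine congrArg _ ?_
    have hbF : b.1 ∈ F := by
      rw [hF, Set.Finite.mem_toFinset]
      exact ⟨b, hb, rfl⟩
    rw [ht, DFinsupp.finsetSum_apply, Finset.sum_eq_single_of_mem _ hbF]
    · exact (DirectSum.of_eq_same _ _).symm
    · intro y _ hy
      exact DirectSum.of_eq_of_ne _ _ _ hy.symm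

/-- An m with non-zero germ at x lies outside `orbitNull`, so by simplicity that submodule is zero;
it contains fm for every f annihilating Ind_x(S_x). -/
theorem IsSimpleRep.annihilator_eq_annihilator_ind {ρ : Gamma O →ₙ+* AddMonoid.End S}
    (hρ : IsSimpleRep ρ) {x : X} (hx : Nontrivial (GermModule ρ x)) :
    annihilator ρ = annihilator (ind O x (GermModule ρ x)) := by
  refine le_antisymm (annihilator_le_annihilator_ind ρ x) fun f hf => ?_
  have hN : orbitNull ρ x = ⊥ := by
    refine (hρ.eq_bot_or_eq_top _ fun f m hm => rep_mem_orbitNull ρ f hm).resolve_right fun h => ?_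
    obtain ⟨s, hs⟩ := exists_ne (0 : GermModule ρ x)
    obtain ⟨m, rfl⟩ := germ_surjective ρ s
    exact hs ((h ▸ AddSubgroup.mem_top m : m ∈ orbitNull ρ x) x ⟨𝟙 x⟩)
  refine (TwoSidedIdeal.mem_ker _).2 (AddMonoidHom.ext fun m => ?_)
  have h := rep_mem_orbitNull_of_mem_annihilator ρ hf m
  rw [hN] at h
  exact AddSubgroup.mem_bot.1 h

end AmpleSheaf

end

open CategoryTheory AmpleSheaf
theorem mainTheorem3 {X : Type u} [TopologicalSpace X] [Groupoid.{v} X] [AmpleGroupoid X]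
    (O : SheafOfRings.{u, v, w} X) (I : TwoSidedIdeal (Gamma O)) (hI : IsPrimitiveIdeal.{z} I) :
    (∃ (x : X) (M : Type z) (_ : AddCommGroup M) (_ : Module (IsotropyRing O x) M),
      I = annihilator (ind O x M)) ∧
    ∀ (S : Type z) [AddCommGroup S] (ρ : Gamma O →ₙ+* AddMonoid.End S),
      IsSimpleRep ρ → I = annihilator ρ →
        (∃ x : X, Nontrivial ((sheafOfModule ρ).stalk x)) ∧
        ∀ x : X, Nontrivial ((sheafOfModule ρ).stalk x) →
          I = annihilator (ind O x ((sheafOfModule ρ).stalk x)) := by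
  refine ⟨?_, fun S _ ρ hρ h => ⟨hρ.exists_nontrivial_germModule, fun x hx =>
    h.trans (hρ.annihilator_eq_annihilator_ind hx)⟩⟩
  obtain ⟨S, _, ρ, hρ, rfl⟩ := hI
  obtain ⟨x, hx⟩ := hρ.exists_nontrivial_germModule
  exact ⟨x, (sheafOfModule ρ).stalk x, inferInstance, inferInstance,
    hρ.annihilator_eq_annihilator_ind hx⟩
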